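/- Let $m>1$ be an integer and $\Sigma=\{\alpha_1,\dots,\alpha_m\}\cup\{\beta_1,\dots,\beta_m\}$. Let $M$ be the Dyck monoid, i.e. the monoid with zero generated by $\Sigma$ subject to the relations $\alpha_j\beta_j\equiv 1$ for all $j$ and $\alpha_i\beta_j\equiv 0$ for $i\neq j$, and let $$X=\{x\in\Sigma^{\mathbb Z} : x_r x_{r+1}\cdots x_l\not\equiv 0 \ (\mathrm{mod}\ M)\ \text{for all integers } r\le l\}$$ be the two-sided $m$-Dyck shift. The double-tail relation of $X$ is $$\mathcal T_2=\{(x,x')\in X\times X : \exists n\ge 0\ \forall |k|>n\ \ x_k=x'_k\}.$$ A $\mathcal T_2$-holonomy is an injective Borel map $g:A\to g(A)$, with $A\subseteq X$ a Borel set, such that $(x,g(x))\in\mathcal T_2$ for every $x\in A$. A Borel probability $\mu$ on $X$ is called $\mathcal T_2$-invariant if $\mu(A)=\mu(g(A))$ for every $\mathcal T_2$-holonomy $g:A\to g(A)$. For $z\in\{0,1\}^{\mathbb Z}$ let $\tilde H_0(z)=0$, $\tilde H_i(z)=\sum_{j=0}^{i-1}(\delta_{1,z_j}-\delta_{0,z_j})$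 for $i>0$ and $\tilde H_i(z)=\sum_{j=i}^{-1}(\delta_{0,z_j}-\delta_{1,z_j})$ for $i<0$. Let $$S=\{z\in\{0,1\}^{\mathbb Z} : \liminf_{n\to+\infty}\tilde H_n(z)=-\infty,\ \liminf_{n\to-\infty}\tilde H_n(z)=-\infty\}.$$ For $z\in S$ put $\gamma_k(z)=\sum_{i=0}^{k}z_i$ if $k\ge 0$, $\gamma_k(z)=-\sum_{i=k}^{-1}z_i$ if $k<0$, and $\varepsilon_n(z)=\max\{l<n : \tilde H_l(z)\le\tilde H_{n+1}(z)\}$. Define $F:S\times\{1,\dots,m\}^{\mathbb Z}\to\Sigma^{\mathbb Z}$ by $F(z,a)_n=\alpha_j$ if $z_n=1$ and $a_{\gamma_n(z)}=j$, and $F(z,a)_n=\beta_j$ if $z_n=0$ and $a_{\gamma_k(z)}=j$, where $k=\varepsilon_n(z)$. Let $\mu_1$ and $\mu_2$ be the symmetric (uniform) product probability measures on $\{0,1\}^{\mathbb Z}$ and on $\{1,\dots,m\}^{\mathbb Z}$, respectively, and let $\tilde\mu=(\mu_1\times\mu_2)\circ F^{-1}$. Then $\tilde\mu$ is a probability measure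 with $\tilde\mu(X)=1$, and it is $\mathcal T_2$-invariant. -/

import Mathlib

open MeasureTheory Filter

/-! ### The double-tail (homoclinic) relation -/

/-- The double-tail relation of `X ⊆ S^ℤ`: two points of `X` that agree at all coordinates
of large absolute value. -/
def DoubleTail {S : Type*} (X : Set (ℤ → S)) (x x' : ℤ → S) : Prop :=
  x ∈ X ∧ x' ∈ X ∧ ∃ n : ℕ, ∀ k : ℤ, (n : ℤ) < |k| → x k = x' k

/-- `g : A → g(A)` is a holonomy of the double-tail relation of `X`: `A` is Borel, `g` is Borel
and injective on `A`, and `(x, g x)` is in the relation for every `x ∈ A` (so `A ⊆ X`).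
The values of `g` outside `A` play no role. -/
structure IsDoubleTailHolonomy {S : Type*} [MeasurableSpace S] (X A : Set (ℤ → S))
    (g : (ℤ → S) → (ℤ → S)) : Prop where
  measurableSet : MeasurableSet A
  measurable : Measurable (A.domRestrict g)
  injOn : Set.InjOn g A
  rel : ∀ x ∈ A, DoubleTail X x (g x)

/-- `μ` is a probability measure on `X` (as a measure on `S^ℤ` giving full mass to `X`) that is
preserved by all holonomies of the double-tail relation of `X`. -/
structure IsDoubleTailInvariantProbability {S : Type*} [MeasurableSpace S] (X : Set (ℤ → S))
    (μ : Measure (ℤ → S)) : Prop where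
  isProbabilityMeasure : IsProbabilityMeasure μ
  measure_eq_one : μ X = 1
  measure_image : ∀ (A : Set (ℤ → S)) (g : (ℤ → S) → (ℤ → S)),
    IsDoubleTailHolonomy X A g → μ A = μ (g '' A)

/-! ### The Dyck shift -/

/-- The alphabet `{α_1, …, α_m} ∪ {β_1, …, β_m}`: `Sum.inl j` is the opening bracket `α_j` and
`Sum.inr j` is the closing bracket `β_j`. -/
abbrev DyckAlphabet (m : ℕ) : Type := Fin m ⊕ Fin m

/-- A word, as an element of the free monoid with zero on the alphabet. -/
def dyckWord {m : ℕ} (w : List (DyckAlphabet m)) : WithZero (FreeMonoid (DyckAlphabet m)) :=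
  ((FreeMonoid.ofList w : FreeMonoid (DyckAlphabet m)) : WithZero (FreeMonoid (DyckAlphabet m)))

/-- The defining relations of the Dyck monoid: `α_j β_j = 1`, and `α_i β_j = 0` for `i ≠ j`. -/
inductive DyckRel (m : ℕ) : WithZero (FreeMonoid (DyckAlphabet m)) →
    WithZero (FreeMonoid (DyckAlphabet m)) → Prop
  | cancel (j : Fin m) : DyckRel m (dyckWord [Sum.inl j, Sum.inr j]) 1
  | zero (i j : Fin m) (h : i ≠ j) : DyckRel m (dyckWord [Sum.inl i, Sum.inr j]) 0

/-- Congruence modulo the Dyck monoid `M`; `M` is the quotient of the free monoid with zero by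
this congruence. -/
def dyckCon (m : ℕ) : Con (WithZero (FreeMonoid (DyckAlphabet m))) :=
  conGen (DyckRel m)

/-- The Dyck language: the words that are not congruent to `0`. -/
def dyckLanguage (m : ℕ) : Set (List (DyckAlphabet m)) :=
  {w | ¬ dyckCon m (dyckWord w) 0}

/-- The block `x_r x_{r+1} ⋯ x_l` (for `r ≤ l`). -/
def block {S : Type*} (x : ℤ → S) (r l : ℤ) : List S :=
  (List.range (l + 1 - r).toNat).map fun i => x (r + i)

/-- The two-sided Dyck shift. -/
def dyckShift (m : ℕ) : Set (ℤ → DyckAlphabet m) :=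
  {x | ∀ r l : ℤ, r ≤ l → block x r l ∈ dyckLanguage m}

/-! ### The bracket-matching map and the measure -/

/-- The height cocycle of a `0`-`1` sequence (`1` is a step up, `0` is a step down). -/
noncomputable def height (z : ℤ → Fin 2) (i : ℤ) : ℤ :=
  if 0 < i then
    ∑ j ∈ Finset.Ico 0 i, ((if z j = 1 then 1 else 0) - (if z j = 0 then 1 else 0))
  else if i < 0 then
    ∑ j ∈ Finset.Ico i 0, ((if z j = 0 then 1 else 0) - (if z j = 1 then 1 else 0))
  else 0

/-- The sequences whose height has lower limit `-∞` in both directions. -/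
def balancedSet : Set (ℤ → Fin 2) :=
  {z | liminf (fun n : ℤ => ((height z n : ℝ) : EReal)) atTop = ⊥ ∧
       liminf (fun n : ℤ => ((height z n : ℝ) : EReal)) atBot = ⊥}

/-- The signed number of ones between the origin and the position `k`. -/
noncomputable def onesCount (z : ℤ → Fin 2) (k : ℤ) : ℤ :=
  if 0 ≤ k then ∑ i ∈ Finset.Icc 0 k, ((z i : ℕ) : ℤ)
  else -∑ i ∈ Finset.Icc k (-1), ((z i : ℕ) : ℤ)

/-- `max {l < n : H_l(z) ≤ H_{n+1}(z)}`. The set is bounded above, and for `z ∈ balancedSet`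
it is nonempty, so that the supremum is a maximum. -/
noncomputable def matchPos (z : ℤ → Fin 2) (n : ℤ) : ℤ :=
  sSup {l : ℤ | l < n ∧ height z l ≤ height z (n + 1)}

/-- The bracket-matching map `F`. It is only meant for `z ∈ balancedSet`; its values elsewhere
play no role. -/
noncomputable def bracketMap (m : ℕ) (p : (ℤ → Fin 2) × (ℤ → Fin m)) : ℤ → DyckAlphabet m :=
  fun n =>
    if p.1 n = 1 then Sum.inl (p.2 (onesCount p.1 n))
    else Sum.inr (p.2 (onesCount p.1 (matchPos p.1 n)))

/-- The symmetric product measure on `{1, …, k}^ℤ`. -/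
noncomputable def symmetricProduct (k : ℕ) [NeZero k] : Measure (ℤ → Fin k) :=
  Measure.infinitePi fun _ : ℤ => (PMF.uniformOfFintype (Fin k)).toMeasure

/-- The image of `μ₁ × μ₂` under the map `F`, whose domain is `balancedSet × {1, …, m}^ℤ`. -/
noncomputable def dyckMeasure (m : ℕ) [NeZero m] : Measure (ℤ → DyckAlphabet m) :=
  (((symmetricProduct 2).prod (symmetricProduct m)).restrict
    (balancedSet ×ˢ Set.univ)).map (bracketMap m)

/-!
Under `bracketMap`, matched brackets carry the same label and the labels of the opening brackets are
independent and uniform. Replacing a well-bracketed word at `[r, l)` by another one of the same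
length changes neither the matching outside of `[r, l)` nor the number of independent labels read in
a window containing `[r, l)`, so it carries a cylinder set to one of the same measure.

Let `x` and `y` be double-tail equivalent. Their heights differ by a constant `c₁` far to the left
and by a constant `c₂` far to the right. For a low level `h`, the bracket that `x` opens last at the
height `h` before the window of disagreement is closed, in `y`, by the bracket that in `x` closes
the one opened at the height `h + c₁ - c₂`. If `c₁ = c₂`, then `x` and `y` differ by an exchange of
well-bracketed words. Otherwise the labels of the open brackets of `x` are periodic from some depth
on, which for `m > 1` has probability zero.
-/

/-! ### Heights and counts of ones -/

section Height

variable {z z' : ℤ → Fin 2} {n p q : ℤ}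

lemma fin_two_ne_one {i : Fin 2} : i ≠ 1 ↔ i = 0 := by
  fin_cases i <;> simp

lemma height_of_nonneg (z : ℤ → Fin 2) (hn : 0 ≤ n) :
    height z n = ∑ j ∈ Finset.Ico 0 n, if z j = 1 then 1 else -1 := by
  have hstep : ∀ j, ((if z j = 1 then 1 else 0) - (if z j = 0 then 1 else 0) : ℤ) =
      if z j = 1 then 1 else -1 := fun j => by
    by_cases h : z j = 1 <;> simp [h, fin_two_ne_one.1]
  rcases hn.eq_or_lt with rfl | hn
  · simp [height]
  · simp only [height, if_pos hn, hstep]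

lemma height_of_nonpos (z : ℤ → Fin 2) (hn : n ≤ 0) :
    height z n = -∑ j ∈ Finset.Ico n 0, if z j = 1 then 1 else -1 := by
  have hstep : ∀ j, ((if z j = 0 then 1 else 0) - (if z j = 1 then 1 else 0) : ℤ) =
      -if z j = 1 then 1 else -1 := fun j => by
    by_cases h : z j = 1 <;> simp [h, fin_two_ne_one.1]
  rcases hn.eq_or_lt with rfl | hn
  · simp [height]
  · simp only [height, if_neg hn.not_gt, if_pos hn, hstep, Finset.sum_neg_distrib]

lemma height_zero (z : ℤ → Fin 2) : height z 0 = 0 := by simp [height]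

lemma height_succ (z : ℤ → Fin 2) (n : ℤ) :
    height z (n + 1) = height z n + if z n = 1 then 1 else -1 := by
  rcases le_or_gt 0 n with hn | hn
  · rw [height_of_nonneg z hn, height_of_nonneg z (hn.trans (Int.le_add_one le_rfl)),
      ← Finset.insert_Ico_right_eq_Ico_add_one hn,
      Finset.sum_insert Finset.right_notMem_Ico, add_comm]
  · rw [height_of_nonpos z hn.le, height_of_nonpos z (Int.add_one_le_of_lt hn),
      ← Finset.insert_Ico_add_one_left_eq_Ico hn, Finset.sum_insert (by simp)]
    ring

lemma height_succ_of_one (h : z n = 1) : height z (n + 1) = height z n + 1 := by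
  rw [height_succ, if_pos h]

lemma height_succ_of_ne_one (h : z n ≠ 1) : height z (n + 1) = height z n - 1 := by
  rw [height_succ, if_neg h, sub_eq_add_neg]

lemma height_le_height_succ_add_one (z : ℤ → Fin 2) (n : ℤ) :
    height z n ≤ height z (n + 1) + 1 := by
  rw [height_succ]; split_ifs <;> omega

lemma height_succ_le (z : ℤ → Fin 2) (n : ℤ) : height z (n + 1) ≤ height z n + 1 := by
  rw [height_succ]; split_ifs <;> omega

lemma eq_one_of_height_lt (h : height z n < height z (n + 1)) : z n = 1 := by
  by_contra h1
  have := height_succ_of_ne_one h1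
  omega

lemma ne_one_of_height_lt (h : height z (n + 1) < height z n) : z n ≠ 1 := by
  intro h1
  have := height_succ_of_one h1
  omega

lemma height_sub_congr (hpq : p ≤ q) (h : Set.EqOn z z' (Set.Ico p q)) :
    height z q - height z p = height z' q - height z' p := by
  induction q, hpq using Int.leInduction with
  | base => simp
  | succ q hpq ih =>
    have ih := ih (h.mono (Set.Ico_subset_Ico_right (Int.le_add_one le_rfl)))
    rw [height_succ, height_succ, h ⟨hpq, Int.lt_succ q⟩]
    omega

lemma height_sub_eq_card (z : ℤ → Fin 2) (hpq : p ≤ q) :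
    height z q - height z p = 2 * ((Finset.Ico p q).filter fun j => z j = 1).card - (q - p) := by
  induction q, hpq using Int.leInduction with
  | base => simp
  | succ q hpq ih =>
    rw [height_succ, ← Finset.insert_Ico_right_eq_Ico_add_one hpq, Finset.filter_insert]
    split_ifs
    · rw [Finset.card_insert_of_notMem (by simp)]
      push_cast
      omega
    · omega

lemma strictMonoOn_onesCount (z : ℤ → Fin 2) : StrictMonoOn (onesCount z) {n | z n = 1} := by
  intro i (hi : z i = 1) j (hj : z j = 1) hij
  have sum_lt_sum {s t : Finset ℤ} {k : ℤ} (hst : s ⊆ t) (hk : k ∈ t) (hks : k ∉ s)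
      (hz : z k = 1) : ∑ i ∈ s, ((z i : ℕ) : ℤ) < ∑ i ∈ t, ((z i : ℕ) : ℤ) :=
    Finset.sum_lt_sum_of_subset hst hk hks (by simp [hz]) fun i _ _ => Int.natCast_nonneg _
  unfold onesCount
  split_ifs with h0i h0j h0j
  · exact sum_lt_sum (Finset.Icc_subset_Icc_right hij.le) (Finset.right_mem_Icc.2 h0j)
      (by simp [hij]) hj
  · omega
  · have hpos : 0 < ∑ k ∈ Finset.Icc i (-1), ((z k : ℕ) : ℤ) :=
      sum_lt_sum (Finset.empty_subset _) (Finset.left_mem_Icc.2 (by omega))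
        (Finset.notMem_empty i) hi
    have hnonneg : 0 ≤ ∑ k ∈ Finset.Icc 0 j, ((z k : ℕ) : ℤ) :=
      Finset.sum_nonneg fun k _ => Int.natCast_nonneg _
    omega
  · exact neg_lt_neg (sum_lt_sum (Finset.Icc_subset_Icc_left hij.le)
      (Finset.left_mem_Icc.2 (by omega)) (by simp [hij]) hi)

lemma measurable_height (n : ℤ) : Measurable fun z : ℤ → Fin 2 => height z n := by
  have hstep (j : ℤ) : Measurable fun z : ℤ → Fin 2 => if z j = 1 then (1 : ℤ) else -1 :=
    (measurable_of_countable fun a : Fin 2 => if a = 1 then (1 : ℤ) else -1).comp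
      (measurable_pi_apply j)
  rcases le_total 0 n with hn | hn
  · simp only [height_of_nonneg _ hn]
    exact Finset.measurable_sum _ fun j _ => hstep j
  · simp only [height_of_nonpos _ hn]
    exact (Finset.measurable_sum _ fun j _ => hstep j).neg

lemma measurable_onesCount (n : ℤ) : Measurable fun z : ℤ → Fin 2 => onesCount z n := by
  have hval (j : ℤ) : Measurable fun z : ℤ → Fin 2 => ((z j : ℕ) : ℤ) :=
    (measurable_of_countable fun a : Fin 2 => ((a : ℕ) : ℤ)).comp (measurable_pi_apply j)
  unfold onesCount
  split_ifs
  · exact Finset.measurable_sum _ fun j _ => hval j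
  · exact (Finset.measurable_sum _ fun j _ => hval j).neg

end Height

section LastBelow

variable {z : ℤ → Fin 2} {n k p M N : ℤ}

/-- The last time before `n` at which the height is at most `k`; it carries the bracket that is
open at time `n` and starts at height `k`. The supremum is a maximum as soon as there is such a
time, which is the case for `z ∈ balancedSet`. -/
noncomputable def lastBelow (z : ℤ → Fin 2) (n k : ℤ) : ℤ :=
  sSup {l : ℤ | l < n ∧ height z l ≤ k}

lemma matchPos_eq_lastBelow (z : ℤ → Fin 2) (n : ℤ) :
    matchPos z n = lastBelow z n (height z (n + 1)) := rfl

lemma isGreatest_lastBelow (h : ∃ l < n, height z l ≤ k) :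
    IsGreatest {l : ℤ | l < n ∧ height z l ≤ k} (lastBelow z n k) :=
  have hbdd : BddAbove {l : ℤ | l < n ∧ height z l ≤ k} := ⟨n, fun _ hl => hl.1.le⟩
  ⟨Int.csSup_mem h hbdd, fun _ hl => le_csSup hbdd hl⟩

lemma lastBelow_eq (hp : p < n) (hk : height z p ≤ k)
    (hgt : ∀ l, p < l → l < n → k < height z l) : lastBelow z n k = p :=
  IsGreatest.csSup_eq ⟨⟨hp, hk⟩, fun l hl => not_lt.1 fun hpl => (hgt l hpl hl.1).not_ge hl.2⟩

lemma lt_height_of_lastBelow_lt {l : ℤ} (h : ∃ l < n, height z l ≤ k)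
    (hl : lastBelow z n k < l) (hln : l < n) : k < height z l :=
  not_le.1 fun hk => hl.not_ge ((isGreatest_lastBelow h).2 ⟨hln, hk⟩)

lemma lastBelow_eq_of_forall_lt (hMN : M ≤ N) (h : ∀ l, M ≤ l → l < N → k < height z l) :
    lastBelow z N k = lastBelow z M k := by
  unfold lastBelow
  congr 1
  ext l
  exact ⟨fun hl => ⟨not_le.1 fun hMl => (h l hMl hl.1).not_ge hl.2, hl.2⟩,
    fun hl => ⟨hl.1.trans_le hMN, hl.2⟩⟩

lemma lastBelow_succ_of_le (h : height z n ≤ k) : lastBelow z (n + 1) k = n :=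
  lastBelow_eq (Int.lt_succ n) h fun _ _ _ => by omega

lemma lastBelow_succ_of_lt (h : k < height z n) : lastBelow z (n + 1) k = lastBelow z n k :=
  lastBelow_eq_of_forall_lt (Int.le_add_one le_rfl) fun l _ _ => by rwa [show l = n by omega]

lemma lt_height_lastBelow_add_one (h : ∃ l < n, height z l ≤ k) (hk : k < height z n) :
    k < height z (lastBelow z n k + 1) := by
  rcases (Int.add_one_le_of_lt (isGreatest_lastBelow h).1.1).eq_or_lt with h1 | h1
  · rwa [h1]
  · exact lt_height_of_lastBelow_lt h (Int.lt_succ _) h1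

lemma height_lastBelow (h : ∃ l < n, height z l ≤ k) (hk : k < height z n) :
    height z (lastBelow z n k) = k := by
  have hle := (isGreatest_lastBelow h).1.2
  have hlt := lt_height_lastBelow_add_one h hk
  have hsucc := height_succ_le z (lastBelow z n k)
  omega

lemma apply_lastBelow (h : ∃ l < n, height z l ≤ k) (hk : k < height z n) :
    z (lastBelow z n k) = 1 :=
  eq_one_of_height_lt ((isGreatest_lastBelow h).1.2.trans_lt (lt_height_lastBelow_add_one h hk))

lemma lastBelow_eq_iff : lastBelow z n k = p ↔
    (p < n ∧ height z p ≤ k ∧ ∀ l, p < l → l < n → k < height z l) ∨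
      ((∀ l < n, k < height z l) ∧ p = 0) := by
  by_cases h : ∃ l < n, height z l ≤ k
  · have hfalse : ¬ ∀ l < n, k < height z l := by simpa only [not_forall, not_lt, exists_prop]
    simp only [hfalse, false_and, or_false]
    constructor
    · rintro rfl
      have hmax := isGreatest_lastBelow h
      exact ⟨hmax.1.1, hmax.1.2, fun l => lt_height_of_lastBelow_lt h⟩
    · exact fun ⟨hp, hk, hgt⟩ => lastBelow_eq hp hk hgt
  · push Not at h
    have hempty : {l : ℤ | l < n ∧ height z l ≤ k} = ∅ :=
      Set.eq_empty_of_forall_notMem fun l hl => (h l hl.1).not_ge hl.2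
    have hzero : lastBelow z n k = 0 := by rw [lastBelow, hempty, Int.csSup_empty]
    rw [hzero]
    exact ⟨fun hp => Or.inr ⟨h, hp.symm⟩,
      Or.rec (fun hp => absurd hp.2.1 (h p hp.1).not_ge) fun hp => hp.2.symm⟩

lemma measurable_lastBelow (n k : ℤ) : Measurable fun z : ℤ → Fin 2 => lastBelow z n k := by
  refine measurable_to_countable' fun p => ?_
  have hle (l : ℤ) : Measurable fun z : ℤ → Fin 2 => height z l ≤ k :=
    measurableSet_setOfPred.1 (measurableSet_le (measurable_height l) measurable_const)
  have hlt (l : ℤ) : Measurable fun z : ℤ → Fin 2 => k < height z l :=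
    measurableSet_setOfPred.1 (measurableSet_lt measurable_const (measurable_height l))
  simp only [Set.preimage, Set.mem_singleton_iff, lastBelow_eq_iff]
  exact measurableSet_setOfPred.2 <| (measurable_const.and <| (hle p).and <| Measurable.forall
    fun l => measurable_const.imp <| measurable_const.imp (hlt l)).or <|
    (Measurable.forall fun l => measurable_const.imp (hlt l)).and measurable_const

lemma measurable_apply_index {Ω ι α : Type*} [MeasurableSpace Ω] [MeasurableSpace ι] [Countable ι]
    [MeasurableSingletonClass ι] [MeasurableSpace α] {f : Ω → ι → α} {k : Ω → ι}
    (hf : ∀ i, Measurable fun ω => f ω i) (hk : Measurable k) :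
    Measurable fun ω => f ω (k ω) :=
  (measurable_from_prod_countable_right (f := fun p : ι × Ω => f p.2 p.1) hf).comp
    (hk.prodMk measurable_id)

lemma measurable_matchPos (n : ℤ) : Measurable fun z : ℤ → Fin 2 => matchPos z n :=
  measurable_apply_index (f := fun z => lastBelow z n) (measurable_lastBelow n)
    (measurable_height (n + 1))

end LastBelow

/-! ### Balanced sequences -/

section Balanced

variable {z : ℤ → Fin 2}

lemma liminf_intCast_eq_bot_iff {α : Type*} {f : α → ℤ} {l : Filter α} :
    liminf (fun n => ((f n : ℝ) : EReal)) l = ⊥ ↔ ∀ k : ℤ, ∃ᶠ n in l, f n ≤ k := by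
  constructor
  · intro h k
    have hlt : liminf (fun n => ((f n : ℝ) : EReal)) l < ((k : ℝ) : EReal) :=
      h ▸ EReal.bot_lt_coe _
    exact (frequently_lt_of_liminf_lt (by isBoundedDefault) hlt).mono fun n hn => by
      exact_mod_cast hn.le
  · intro h
    rw [EReal.eq_bot_iff_forall_lt]
    intro y
    obtain ⟨k, hk⟩ := exists_int_lt y
    have hle : liminf (fun n => ((f n : ℝ) : EReal)) l ≤ ((k : ℝ) : EReal) :=
      liminf_le_of_frequently_le ((h k).mono fun n hn => by exact_mod_cast hn)
        (by isBoundedDefault)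
    exact hle.trans_lt (by exact_mod_cast hk)

lemma mem_balancedSet_iff : z ∈ balancedSet ↔
    (∀ k : ℤ, ∃ᶠ n in atTop, height z n ≤ k) ∧ ∀ k : ℤ, ∃ᶠ n in atBot, height z n ≤ k := by
  rw [← liminf_intCast_eq_bot_iff, ← liminf_intCast_eq_bot_iff]
  rfl

lemma exists_lt_height_le (hz : z ∈ balancedSet) (n k : ℤ) : ∃ l < n, height z l ≤ k :=
  frequently_atBot'.1 ((mem_balancedSet_iff.1 hz).2 k) n

lemma exists_gt_height_le (hz : z ∈ balancedSet) (n k : ℤ) : ∃ l > n, height z l ≤ k :=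
  frequently_atTop'.1 ((mem_balancedSet_iff.1 hz).1 k) n

lemma measurableSet_balancedSet : MeasurableSet balancedSet := by
  have hle (n k : ℤ) : Measurable fun z : ℤ → Fin 2 => height z n ≤ k :=
    measurableSet_setOfPred.1 (measurableSet_le (measurable_height n) measurable_const)
  have hiff : balancedSet = {z | (∀ k N : ℤ, ∃ n, n ≥ N ∧ height z n ≤ k) ∧
      ∀ k N : ℤ, ∃ n, n ≤ N ∧ height z n ≤ k} := by
    ext z
    simp only [mem_balancedSet_iff, frequently_atTop, frequently_atBot, Set.mem_ofPred_eq]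
  rw [hiff]
  exact measurableSet_setOfPred.2 <|
    (Measurable.forall fun k => Measurable.forall fun _ => Measurable.exists fun n =>
      measurable_const.and (hle n k)).and
    (Measurable.forall fun k => Measurable.forall fun _ => Measurable.exists fun n =>
      measurable_const.and (hle n k))

end Balanced

/-! ### Recurrence of the symmetric random walk -/

section Recurrence

variable {Ω : Type*} [MeasurableSpace Ω] {μ : Measure Ω}

lemma martingale_sum_range_succ {E : Type*} [NormedAddCommGroup E] [NormedSpace ℝ E]
    [CompleteSpace E] [SecondCountableTopology E] [MeasurableSpace E] [BorelSpace E]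
    {ξ : ℕ → Ω → E} (hmeas : ∀ n, StronglyMeasurable (ξ n))
    (hindep : ProbabilityTheory.iIndepFun ξ μ) (hint : ∀ n, Integrable (ξ n) μ)
    (hmean : ∀ n, ∫ ω, ξ n ω ∂μ = 0) :
    Martingale (fun n ω => ∑ k ∈ Finset.range (n + 1), ξ k ω) (Filtration.natural ξ hmeas) μ := by
  have := hindep.isProbabilityMeasure
  refine martingale_of_condExp_sub_eq_zero_nat
    (fun n => Finset.stronglyMeasurable_fun_sum _ fun k hk =>
      (Filtration.stronglyAdapted_natural hmeas k).mono
        (Filtration.mono _ (Finset.mem_range_succ_iff.1 hk)))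
    (fun n => integrable_finsetSum _ fun k _ => hint k) fun n => ?_
  have hdiff : ((fun ω => ∑ k ∈ Finset.range (n + 1 + 1), ξ k ω) -
      fun ω => ∑ k ∈ Finset.range (n + 1), ξ k ω) = ξ (n + 1) := by
    funext ω
    simp [Finset.sum_range_succ _ (n + 1)]
  rw [hdiff]
  exact (hindep.condExp_natural_ae_eq_of_lt hmeas (Nat.lt_succ_self n)).trans
    (ae_of_all _ fun _ => hmean _)

/-- By martingale convergence, a path that is bounded below would converge. -/
lemma ae_not_bddBelow_of_martingale [IsFiniteMeasure μ] {ℱ : Filtration ℕ ‹MeasurableSpace Ω›}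
    {f : ℕ → Ω → ℝ} (hf : Martingale f ℱ μ) {r : NNReal} (hr : r ≠ 0)
    (hstep : ∀ᵐ ω ∂μ, ∀ n, |f (n + 1) ω - f n ω| = r) :
    ∀ᵐ ω ∂μ, ¬ BddBelow (Set.range fun n => f n ω) := by
  have hstep_le : ∀ᵐ ω ∂μ, ∀ n, |f (n + 1) ω - f n ω| ≤ r :=
    hstep.mono fun ω h n => (h n).le
  filter_upwards [hstep, hf.bddAbove_range_iff_bddBelow_range hstep_le,
    hf.submartingale.bddAbove_iff_exists_tendsto hstep_le] with ω hω hbdd hconv hbelow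
  obtain ⟨c, hc⟩ := hconv.1 (hbdd.2 hbelow)
  have hlim := ((hc.comp (tendsto_add_atTop_nat 1)).sub hc).abs
  simp only [Function.comp_apply, hω, sub_self, abs_zero] at hlim
  exact hr (NNReal.coe_eq_zero.1 (tendsto_nhds_unique tendsto_const_nhds hlim))

instance symmetricProduct.instIsProbabilityMeasure (k : ℕ) [NeZero k] :
    IsProbabilityMeasure (symmetricProduct k) := by
  unfold symmetricProduct; infer_instance

lemma uniformOfFintype_toMeasure_singleton {α : Type*} [Fintype α] [Nonempty α]
    [MeasurableSpace α] [MeasurableSingletonClass α] (a : α) :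
    (PMF.uniformOfFintype α).toMeasure {a} = (Fintype.card α : ENNReal)⁻¹ := by
  rw [PMF.toMeasure_apply_singleton _ _ (measurableSet_singleton a), PMF.uniformOfFintype_apply]

lemma integral_apply_symmetricProduct {k : ℕ} [NeZero k] (n : ℤ) (ε : Fin k → ℝ) :
    ∫ z, ε (z n) ∂symmetricProduct k = (k : ℝ)⁻¹ * ∑ a, ε a := by
  have heval := measurePreserving_eval_infinitePi
    (fun _ : ℤ => (PMF.uniformOfFintype (Fin k)).toMeasure) n
  calc ∫ z, ε (z n) ∂symmetricProduct k
      = ∫ a, ε a ∂(PMF.uniformOfFintype (Fin k)).toMeasure :=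
        heval.hasLaw.integral_comp
          (measurable_of_countable ε).aestronglyMeasurable
    _ = (k : ℝ)⁻¹ * ∑ a, ε a := by
      rw [integral_fintype Integrable.of_finite, Finset.mul_sum]
      simp [measureReal_def]

lemma ae_not_bddBelow_sum_symmetricProduct {k : ℕ} [NeZero k] {e : ℕ → ℤ}
    (he : Function.Injective e) {ε : Fin k → ℝ} (hsum : ∑ a, ε a = 0) {r : NNReal} (hr : r ≠ 0)
    (habs : ∀ a, |ε a| = r) : ∀ᵐ z ∂symmetricProduct k,
      ¬ BddBelow (Set.range fun n => ∑ i ∈ Finset.range (n + 1), ε (z (e i))) := by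
  have hε : Measurable ε := measurable_of_countable _
  have hmeas (n : ℕ) : StronglyMeasurable fun z : ℤ → Fin k => ε (z (e n)) :=
    (hε.comp (measurable_pi_apply (e n))).stronglyMeasurable
  have hindep : ProbabilityTheory.iIndepFun (fun n z => ε (z (e n))) (symmetricProduct k) :=
    (ProbabilityTheory.iIndepFun_infinitePi (X := fun _ : ℤ => ε) fun _ => hε).precomp he
  refine ae_not_bddBelow_of_martingale (martingale_sum_range_succ hmeas hindep
    (fun n => Integrable.of_bound (hmeas n).aestronglyMeasurable r
      (ae_of_all _ fun z => (habs _).le)) fun n => ?_) hr (ae_of_all _ fun z n => ?_)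
  · rw [integral_apply_symmetricProduct, hsum, mul_zero]
  · rw [Finset.sum_range_succ _ (n + 1), add_sub_cancel_left, habs]

lemma height_natCast (z : ℤ → Fin 2) (n : ℕ) :
    (height z n : ℝ) = ∑ k ∈ Finset.range n, if z k = 1 then (1 : ℝ) else -1 := by
  induction n with
  | zero => simp [height_zero]
  | succ n ih =>
    rw [Finset.sum_range_succ, ← ih, Nat.cast_succ, height_succ]
    split_ifs <;> simp

lemma height_neg_natCast (z : ℤ → Fin 2) (n : ℕ) :
    (height z (-n) : ℝ) = ∑ k ∈ Finset.range n, if z (-1 - k) = 1 then (-1 : ℝ) else 1 := by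
  induction n with
  | zero => simp [height_zero]
  | succ n ih =>
    have hstep := height_succ z (-1 - n)
    rw [show (-1 - n + 1 : ℤ) = -n by ring] at hstep
    rw [Finset.sum_range_succ, ← ih, show (-((n + 1 : ℕ) : ℤ)) = -1 - n by push_cast; ring, hstep]
    split_ifs <;> simp

lemma frequently_le_of_not_bddBelow_range {u : ℕ → ℤ}
    (h : ¬ BddBelow (Set.range fun n => (u n : ℝ))) (k : ℤ) : ∃ᶠ n in atTop, u n ≤ k := by
  contrapose h
  have hev : ∀ᶠ n in atTop, (k : ℝ) ≤ u n := (not_frequently.1 h).mono fun n hn => by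
    exact_mod_cast (not_le.1 hn).le
  exact (isBoundedUnder_of_eventually_ge hev).bddBelow_range

lemma ae_mem_balancedSet : ∀ᵐ z ∂symmetricProduct 2, z ∈ balancedSet := by
  filter_upwards [
    ae_not_bddBelow_sum_symmetricProduct (e := fun k => (k : ℤ)) Nat.cast_injective
      (ε := fun a => if a = 1 then 1 else -1) (by simp) one_ne_zero
      fun a => by split_ifs <;> simp,
    ae_not_bddBelow_sum_symmetricProduct (e := fun k => (-1 - k : ℤ))
      (sub_right_injective.comp Nat.cast_injective)
      (ε := fun a => if a = 1 then -1 else 1) (by simp) one_ne_zero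
      fun a => by split_ifs <;> simp] with z hright hleft
  simp only [← height_natCast] at hright
  simp only [← height_neg_natCast] at hleft
  have htop : Tendsto (fun n : ℕ => ((n + 1 : ℕ) : ℤ)) atTop atTop :=
    tendsto_natCast_atTop_atTop.comp (tendsto_add_atTop_nat 1)
  exact mem_balancedSet_iff.2
    ⟨fun k => htop.frequently (frequently_le_of_not_bddBelow_range hright k),
      fun k => (tendsto_neg_atTop_atBot.comp htop).frequently
        (frequently_le_of_not_bddBelow_range hleft k)⟩

end Recurrence

/-! ### The Dyck monoid and its action on stacks -/

section Block

variable {S : Type*} {r s l : ℤ}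

/-- In `block` the list of naturals is coerced to a list of integers through the list monad. -/
lemma block_eq_map (x : ℤ → S) (r l : ℤ) :
    block x r l = (List.range (l + 1 - r).toNat).map fun i : ℕ => x (r + i) := by
  simp only [block, List.pure_def, List.bind_eq_flatMap, List.map_flatMap, List.map_cons,
    List.map_nil]
  exact List.map_eq_flatMap.symm

lemma block_of_lt (x : ℤ → S) (h : l < r) : block x r l = [] := by
  rw [block_eq_map, Int.toNat_of_nonpos (by omega), List.range_zero, List.map_nil]

lemma block_succ_right (x : ℤ → S) (h : r ≤ l + 1) :
    block x r (l + 1) = block x r l ++ [x (l + 1)] := by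
  rw [block_eq_map, block_eq_map, show (l + 1 + 1 - r).toNat = (l + 1 - r).toNat + 1 by omega,
    List.range_succ, List.map_append, List.map_singleton,
    show r + ((l + 1 - r).toNat : ℤ) = l + 1 by omega]

lemma block_self (x : ℤ → S) (r : ℤ) : block x r r = [x r] := by
  simpa [block_of_lt x (sub_one_lt r)] using block_succ_right (r := r) (l := r - 1) x (by omega)

lemma block_append (x : ℤ → S) (hrs : r ≤ s) (hsl : s ≤ l + 1) :
    block x r (s - 1) ++ block x s l = block x r l := by
  obtain ⟨k, rfl⟩ : ∃ k, l = k - 1 := ⟨l + 1, by ring⟩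
  rw [sub_add_cancel] at hsl
  induction k, hsl using Int.leInduction with
  | base => rw [block_of_lt x (sub_one_lt s), List.append_nil]
  | succ k hk ih =>
    have hsucc (r : ℤ) (hr : r ≤ k) : block x r (k + 1 - 1) = block x r (k - 1) ++ [x k] := by
      simpa using block_succ_right (l := k - 1) x (by omega)
    rw [hsucc s hk, hsucc r (hrs.trans hk), ← List.append_assoc, ih]

lemma block_eq_append_append (x : ℤ → S) (h : r < l) :
    block x r l = [x r] ++ block x (r + 1) (l - 1) ++ [x l] := by
  rw [← block_self x r, ← block_self x l, List.append_assoc, block_append x (by omega) (by omega),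
    ← block_append x (s := r + 1) (by omega) (by omega), add_sub_cancel_right]

end Block

section DyckMonoid

variable {m : ℕ}

/-- The class of a word in the Dyck monoid. -/
def dyckClass (w : List (DyckAlphabet m)) : (dyckCon m).Quotient :=
  (dyckWord w : (dyckCon m).Quotient)

/-- The zero of the Dyck monoid. -/
def dyckZero (m : ℕ) : (dyckCon m).Quotient :=
  ((0 : WithZero (FreeMonoid (DyckAlphabet m))) : (dyckCon m).Quotient)

lemma mem_dyckLanguage_iff {w : List (DyckAlphabet m)} :
    w ∈ dyckLanguage m ↔ dyckClass w ≠ dyckZero m :=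
  (Con.eq (dyckCon m)).not.symm

lemma dyckClass_nil : dyckClass ([] : List (DyckAlphabet m)) = 1 := rfl

lemma dyckClass_append (u v : List (DyckAlphabet m)) :
    dyckClass (u ++ v) = dyckClass u * dyckClass v := by
  simp only [dyckClass, dyckWord, FreeMonoid.ofList_append, WithZero.coe_mul, Con.coe_mul]

lemma dyckClass_pair_self (j : Fin m) :
    dyckClass ([Sum.inl j, Sum.inr j] : List (DyckAlphabet m)) = 1 :=
  (Con.eq (dyckCon m)).2 (ConGen.Rel.of _ _ (DyckRel.cancel j))

lemma dyckClass_pair_of_ne {i j : Fin m} (h : i ≠ j) :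
    dyckClass ([Sum.inl i, Sum.inr j] : List (DyckAlphabet m)) = dyckZero m :=
  (Con.eq (dyckCon m)).2 (ConGen.Rel.of _ _ (DyckRel.zero i j h))

end DyckMonoid

section Stack

variable {m : ℕ}

/-- One step of the action of brackets on infinite stacks: an opening bracket is pushed; a closing
bracket pops its label, and fails if another label is on top. -/
def stackStep (s : Stream' (Fin m)) : DyckAlphabet m → Option (Stream' (Fin m))
  | Sum.inl j => some (Stream'.cons j s)
  | Sum.inr j => if s.head = j then some s.tail else none

/-- The action of the free monoid with zero on infinite stacks by partial maps. It detects that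
words are not congruent to zero: a word that acts somewhere is in the Dyck language. -/
def stackAct (a : WithZero (FreeMonoid (DyckAlphabet m))) (s : Stream' (Fin m)) :
    Option (Stream' (Fin m)) :=
  WithZero.recZeroCoe (motive := fun _ => Option (Stream' (Fin m))) none
    (fun w => (FreeMonoid.toList w).foldlM stackStep s) a

lemma stackAct_zero (s : Stream' (Fin m)) : stackAct 0 s = none := rfl

lemma stackAct_coe (w : FreeMonoid (DyckAlphabet m)) (s : Stream' (Fin m)) :
    stackAct (w : WithZero (FreeMonoid (DyckAlphabet m))) s =
      (FreeMonoid.toList w).foldlM stackStep s := rfl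

lemma stackAct_mul (a b : WithZero (FreeMonoid (DyckAlphabet m))) (s : Stream' (Fin m)) :
    stackAct (a * b) s = (stackAct a s).bind (stackAct b) := by
  induction a using WithZero.recZeroCoe with
  | zero => rw [zero_mul]; rfl
  | coe a =>
    induction b using WithZero.recZeroCoe with
    | zero =>
      rw [mul_zero]
      cases stackAct (a : WithZero (FreeMonoid (DyckAlphabet m))) s <;> rfl
    | coe b =>
      rw [← WithZero.coe_mul, stackAct_coe, FreeMonoid.toList_mul, List.foldlM_append]
      rfl

/-- The congruence of words that act in the same way on infinite stacks. -/
def stackCon (m : ℕ) : Con (WithZero (FreeMonoid (DyckAlphabet m))) where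
  r a b := stackAct a = stackAct b
  iseqv := ⟨fun _ => rfl, fun h => h.symm, fun h h' => h.trans h'⟩
  mul' h h' := by
    funext s
    rw [stackAct_mul, stackAct_mul, h, h']

lemma dyckCon_le_stackCon : dyckCon m ≤ stackCon m := by
  refine Con.conGen_le.2 ?_
  rintro _ _ (⟨j⟩ | ⟨i, j, h⟩)
  · funext s
    change [Sum.inl j, Sum.inr j].foldlM stackStep s = some s
    simp [List.foldlM, stackStep]
  · funext s
    change [Sum.inl i, Sum.inr j].foldlM stackStep s = none
    simp [List.foldlM, stackStep, h]

lemma mem_dyckLanguage_of_foldlM_stackStep {w : List (DyckAlphabet m)} {s t : Stream' (Fin m)}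
    (h : w.foldlM stackStep s = some t) : w ∈ dyckLanguage m := by
  intro hzero
  have hact : stackAct (dyckWord w) s = stackAct 0 s := congrFun (dyckCon_le_stackCon hzero) s
  rw [dyckWord, stackAct_coe, FreeMonoid.toList_ofList, h, stackAct_zero] at hact
  cases hact

lemma mem_dyckShift_of_stackStep {x : ℤ → DyckAlphabet m} {s : ℤ → Stream' (Fin m)}
    (h : ∀ n, stackStep (s n) (x n) = some (s (n + 1))) : x ∈ dyckShift m := by
  intro r l hrl
  refine mem_dyckLanguage_of_foldlM_stackStep (s := s r) (t := s (l + 1)) ?_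
  induction l, hrl using Int.leInduction with
  | base => rw [block_self, List.foldlM_cons, h]; rfl
  | succ l hrl ih =>
    rw [block_succ_right x (by omega), List.foldlM_append, ih]
    simp [h]

/-- The labels of the brackets of `bracketMap m (z, a)` that are open at time `n`, from the last
opened one on: the bracket at depth `d` starts at height `height z n - 1 - d`. -/
noncomputable def openLabels (z : ℤ → Fin 2) (a : ℤ → Fin m) (n : ℤ) : Stream' (Fin m) :=
  fun d => a (onesCount z (lastBelow z n (height z n - 1 - d)))

lemma stackStep_openLabels (z : ℤ → Fin 2) (a : ℤ → Fin m) (n : ℤ) :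
    stackStep (openLabels z a n) (bracketMap m (z, a) n) = some (openLabels z a (n + 1)) := by
  by_cases hn : z n = 1
  · have hsucc := height_succ_of_one hn
    simp only [bracketMap, hn, if_true, stackStep]
    congr 1
    funext d
    cases d with
    | zero =>
      change a _ = a _
      rw [lastBelow_succ_of_le (by simp [hsucc])]
    | succ d =>
      change a _ = a _
      rw [lastBelow_succ_of_lt (by push_cast; omega), hsucc]
      congr 3
      push_cast
      ring
  · have hsucc := height_succ_of_ne_one hn
    have hhead : (openLabels z a n).head = a (onesCount z (matchPos z n)) := by
      change a _ = a _
      rw [matchPos_eq_lastBelow, hsucc, Nat.cast_zero, sub_zero]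
    simp only [bracketMap, hn, if_false, stackStep, if_pos hhead]
    congr 1
    funext d
    change a _ = a _
    rw [lastBelow_succ_of_lt (by omega), hsucc]
    congr 3
    push_cast
    ring

lemma bracketMap_mem_dyckShift (p : (ℤ → Fin 2) × (ℤ → Fin m)) : bracketMap m p ∈ dyckShift m :=
  mem_dyckShift_of_stackStep (stackStep_openLabels p.1 p.2)

end Stack

/-! ### Excursions and matched brackets -/

/-- The height makes an excursion on `[r, l]`: it ends where it starts and does not go below. -/
structure Excursion (z : ℤ → Fin 2) (r l : ℤ) : Prop where
  le : r ≤ l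
  height_eq : height z l = height z r
  le_height : ∀ j, r ≤ j → j ≤ l → height z r ≤ height z j

/-- The positions `p < q` hold an opening bracket and the closing bracket that matches it. -/
structure Matched (z : ℤ → Fin 2) (p q : ℤ) : Prop where
  lt : p < q
  height_eq : height z (q + 1) = height z p
  lt_height : ∀ j, p < j → j ≤ q → height z p < height z j

/-- The position of the opening bracket that carries the label read at `n`. -/
noncomputable def openPos (z : ℤ → Fin 2) (n : ℤ) : ℤ := if z n = 1 then n else matchPos z n

section Matching

variable {z z' : ℤ → Fin 2} {r l p q n : ℤ}

lemma openPos_of_one (h : z n = 1) : openPos z n = n := if_pos h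

lemma openPos_of_ne_one (h : z n ≠ 1) : openPos z n = matchPos z n := if_neg h

namespace Matched

lemma opening (h : Matched z p q) : z p = 1 :=
  eq_one_of_height_lt (h.lt_height (p + 1) (Int.lt_succ p) h.lt)

lemma closing (h : Matched z p q) : z q ≠ 1 :=
  ne_one_of_height_lt (h.height_eq ▸ h.lt_height q h.lt le_rfl)

lemma matchPos_eq (h : Matched z p q) : matchPos z q = p := by
  rw [matchPos_eq_lastBelow]
  refine lastBelow_eq h.lt h.height_eq.ge fun j hpj hjq => ?_
  rw [h.height_eq]
  exact h.lt_height j hpj hjq.le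

lemma openPos_eq (h : Matched z p q) : openPos z q = p := by
  rw [openPos_of_ne_one h.closing, h.matchPos_eq]

lemma excursion (h : Matched z p q) : Excursion z p (q + 1) where
  le := h.lt.le.trans (Int.le_add_one le_rfl)
  height_eq := h.height_eq
  le_height j hpj hjq := by
    rcases hpj.eq_or_lt with rfl | hpj
    · exact le_rfl
    rcases hjq.eq_or_lt with rfl | hjq
    · exact h.height_eq.ge
    · exact (h.lt_height j hpj (Int.lt_add_one_iff.1 hjq)).le

lemma inner_excursion (h : Matched z p q) : Excursion z (p + 1) q := by
  have hp := height_succ_of_one h.opening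
  have hq := height_succ_of_ne_one h.closing
  have heq := h.height_eq
  refine ⟨h.lt, by omega, fun j hpj hjq => ?_⟩
  have := h.lt_height j hpj hjq
  omega

lemma notMem_of_excursion (hm : Matched z p q) (h : Excursion z r l) (hq : q ∉ Set.Ico r l) :
    p ∉ Set.Ico r l := by
  intro hp
  have hlq : l ≤ q := not_lt.1 fun hql => hq ⟨hp.1.trans hm.lt.le, hql⟩
  have hlt := hm.lt_height l hp.2 hlq
  have hle := h.le_height p hp.1 hp.2.le
  exact (hlt.trans_le h.height_eq.le).not_ge hle

lemma congr (h : Matched z p q) (hz : Set.EqOn z z' (Set.Icc p q)) : Matched z' p q := by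
  have hsub (j : ℤ) (hpj : p ≤ j) (hjq : j ≤ q + 1) :=
    height_sub_congr (z := z) (z' := z') hpj fun _ hi =>
      hz ⟨hi.1, Int.lt_add_one_iff.1 (hi.2.trans_le hjq)⟩
  refine ⟨h.lt, ?_, fun j hpj hjq => ?_⟩
  · have := hsub (q + 1) (h.lt.le.trans (Int.le_add_one le_rfl)) le_rfl
    have := h.height_eq
    omega
  · have := hsub j hpj.le (hjq.trans (Int.le_add_one le_rfl))
    have := h.lt_height j hpj hjq
    omega

end Matched

lemma matched_matchPos (hn : z n ≠ 1) (h : ∃ l < n, height z l ≤ height z (n + 1)) :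
    Matched z (matchPos z n) n := by
  have hsucc := height_succ_of_ne_one hn
  have hlt : height z (n + 1) < height z n := by omega
  have heq : height z (matchPos z n) = height z (n + 1) := height_lastBelow h hlt
  refine ⟨(isGreatest_lastBelow h).1.1, heq.symm, fun j hpj hjn => heq ▸ ?_⟩
  rcases hjn.eq_or_lt with rfl | hjn
  · exact hlt
  · exact lt_height_of_lastBelow_lt h hpj hjn

lemma matched_openPos (hz : z ∈ balancedSet) (hn : z n ≠ 1) : Matched z (openPos z n) n := by
  rw [openPos_of_ne_one hn]
  exact matched_matchPos hn (exists_lt_height_le hz _ _)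

lemma apply_openPos (hz : z ∈ balancedSet) (n : ℤ) : z (openPos z n) = 1 := by
  by_cases hn : z n = 1
  · rwa [openPos_of_one hn]
  · exact (matched_openPos hz hn).opening

namespace Excursion

lemma congr (h : Excursion z r l) (hz : Set.EqOn z z' (Set.Ico r l)) : Excursion z' r l := by
  have hsub (j : ℤ) (hrj : r ≤ j) (hjl : j ≤ l) :=
    height_sub_congr (z := z) (z' := z') hrj (hz.mono (Set.Ico_subset_Ico_right hjl))
  refine ⟨h.le, ?_, fun j hrj hjl => ?_⟩
  · have := hsub l h.le le_rfl
    have := h.height_eq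
    omega
  · have := hsub j hrj hjl
    have := h.le_height j hrj hjl
    omega

lemma exists_height_eq_add (h : Excursion z r l) (h' : Excursion z' r l)
    (hz : Set.EqOn z z' (Set.Ico r l)ᶜ) :
    ∃ c, ∀ j ∉ Set.Ioo r l, height z' j = height z j + c := by
  refine ⟨height z' r - height z r, fun j hj => ?_⟩
  rcases le_or_gt j r with hjr | hjr
  · have := height_sub_congr (z := z) (z' := z') hjr fun i hi =>
      hz fun hi' => hi.2.not_ge hi'.1
    omega
  · have hlj : l ≤ j := not_lt.1 fun hjl => hj ⟨hjr, hjl⟩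
    have := height_sub_congr (z := z) (z' := z') hlj fun i hi =>
      hz fun hi' => hi'.2.not_ge hi.1
    have := h.height_eq
    have := h'.height_eq
    omega

lemma matched_openPos (h : Excursion z r l) (hn : n ∈ Set.Ico r l) (hz : z n ≠ 1) :
    Matched z (openPos z n) n ∧ r ≤ openPos z n := by
  rw [openPos_of_ne_one hz]
  have hr : height z r ≤ height z (n + 1) := h.le_height _ (hn.1.trans (Int.le_add_one le_rfl)) hn.2
  have hne : r ≠ n := by
    rintro rfl
    have := height_succ_of_ne_one hz
    omega
  have hex : ∃ l < n, height z l ≤ height z (n + 1) := ⟨r, hn.1.lt_of_ne hne, hr⟩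
  exact ⟨matched_matchPos hz hex, (isGreatest_lastBelow hex).2 ⟨hn.1.lt_of_ne hne, hr⟩⟩

lemma openPos_mem (h : Excursion z r l) (hn : n ∈ Set.Ico r l) : openPos z n ∈ Set.Ico r l := by
  by_cases hz : z n = 1
  · rwa [openPos_of_one hz]
  · obtain ⟨hmatched, hle⟩ := h.matched_openPos hn hz
    exact ⟨hle, hmatched.lt.trans hn.2⟩

lemma openPos_notMem (h : Excursion z r l) (hz : z ∈ balancedSet) (hn : n ∉ Set.Ico r l) :
    openPos z n ∉ Set.Ico r l := by
  by_cases hn1 : z n = 1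
  · rwa [openPos_of_one hn1]
  · exact (_root_.matched_openPos hz hn1).notMem_of_excursion h hn

lemma openPos_congr (h : Excursion z r l) (hz : Set.EqOn z z' (Set.Ico r l))
    (hn : n ∈ Set.Ico r l) : openPos z' n = openPos z n := by
  by_cases hn1 : z n = 1
  · rw [openPos_of_one hn1, openPos_of_one (hz hn ▸ hn1)]
  · obtain ⟨hmatched, hle⟩ := h.matched_openPos hn hn1
    have hIcc : Set.EqOn z z' (Set.Icc (openPos z n) n) := fun j hj =>
      hz ⟨hle.trans hj.1, hj.2.trans_lt hn.2⟩
    exact (hmatched.congr hIcc).openPos_eq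

lemma matched_congr_outside (h : Excursion z r l) (h' : Excursion z' r l)
    (hz : Set.EqOn z z' (Set.Ico r l)ᶜ) (hq : q ∉ Set.Ico r l) (hm : Matched z p q) :
    Matched z' p q := by
  obtain ⟨c, hc⟩ := h.exists_height_eq_add h' hz
  have hp := hm.notMem_of_excursion h hq
  have hcp := hc p fun hmem => hp (Set.Ioo_subset_Ico_self hmem)
  have hcq := hc (q + 1) fun hmem => hq ⟨Int.lt_add_one_iff.1 hmem.1, by have := hmem.2; omega⟩
  have heq := hm.height_eq
  refine ⟨hm.lt, by omega, fun j hpj hjq => ?_⟩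
  by_cases hj : j ∈ Set.Ioo r l
  · have hpr : p < r := not_le.1 fun hrp => hp ⟨hrp, hpj.trans hj.2⟩
    have hrc := hc r fun hr => hr.1.false
    have hrlt := hm.lt_height r hpr (hj.1.le.trans hjq)
    have hrj := h'.le_height j hj.1.le hj.2.le
    omega
  · have := hc j hj
    have := hm.lt_height j hpj hjq
    omega

lemma openPos_congr_outside (h : Excursion z r l) (h' : Excursion z' r l)
    (hz : Set.EqOn z z' (Set.Ico r l)ᶜ) (hbal : z ∈ balancedSet) (hn : n ∉ Set.Ico r l) :
    openPos z' n = openPos z n := by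
  by_cases hn1 : z n = 1
  · rw [openPos_of_one hn1, openPos_of_one (hz hn ▸ hn1)]
  · exact (h.matched_congr_outside h' hz hn (_root_.matched_openPos hbal hn1)).openPos_eq

lemma image_openPos (h : Excursion z r l) :
    (Finset.Ico r l).image (openPos z) = (Finset.Ico r l).filter fun j => z j = 1 := by
  ext j
  simp only [Finset.mem_image, Finset.mem_filter, Finset.mem_Ico]
  constructor
  · rintro ⟨n, hn, rfl⟩
    refine ⟨h.openPos_mem hn, ?_⟩
    by_cases hz : z n = 1
    · rwa [openPos_of_one hz]
    · exact (h.matched_openPos hn hz).1.opening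
  · exact fun hj => ⟨j, hj.1, openPos_of_one hj.2⟩

lemma two_mul_card_image_openPos (h : Excursion z r l) :
    (2 * ((Finset.Ico r l).image (openPos z)).card : ℤ) = l - r := by
  have hcard := height_sub_eq_card z h.le
  have heq := h.height_eq
  rw [h.image_openPos]
  omega

lemma exists_matched (h : Excursion z r l) (hrl : r < l) :
    ∃ p ≥ r, Excursion z r p ∧ Matched z p (l - 1) := by
  have hmem : l - 1 ∈ Set.Ico r l := ⟨Int.le_sub_one_of_lt hrl, sub_one_lt l⟩
  have hclosing : z (l - 1) ≠ 1 := fun h1 => by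
    have hsucc := height_succ_of_one h1
    have hle := h.le_height (l - 1) hmem.1 hmem.2.le
    rw [sub_add_cancel, h.height_eq] at hsucc
    omega
  obtain ⟨hmatched, hle⟩ := h.matched_openPos hmem hclosing
  have heq := hmatched.height_eq
  rw [sub_add_cancel, h.height_eq] at heq
  exact ⟨_, hle, ⟨hle, heq.symm, fun j hrj hj =>
    h.le_height j hrj (hj.trans (hmatched.lt.trans hmem.2).le)⟩, hmatched⟩

end Excursion

end Matching

/-! ### Labels of matched brackets -/

section Label

variable {m : ℕ} {x y : ℤ → DyckAlphabet m} {r l p q n : ℤ}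

/-- The pattern of opening (`1`) and closing (`0`) brackets. -/
def bracketType (x : ℤ → DyckAlphabet m) : ℤ → Fin 2 := fun n => if (x n).isLeft then 1 else 0

/-- The label of a bracket. -/
def bracketLabel : DyckAlphabet m → Fin m := Sum.elim id id

lemma bracketType_eq_one_iff : bracketType x n = 1 ↔ x n = Sum.inl (bracketLabel (x n)) := by
  unfold bracketType bracketLabel
  cases x n <;> simp

lemma bracketType_ne_one_iff : bracketType x n ≠ 1 ↔ x n = Sum.inr (bracketLabel (x n)) := by
  unfold bracketType bracketLabel
  cases x n <;> simp

lemma eq_iff_bracketType_bracketLabel : x n = y n ↔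
    bracketType x n = bracketType y n ∧ bracketLabel (x n) = bracketLabel (y n) := by
  unfold bracketType bracketLabel
  cases x n <;> cases y n <;> simp

lemma bracketType_congr (h : x n = y n) : bracketType x n = bracketType y n :=
  (eq_iff_bracketType_bracketLabel.1 h).1

lemma bracketType_bracketMap (p : (ℤ → Fin 2) × (ℤ → Fin m)) :
    bracketType (bracketMap m p) = p.1 := by
  funext n
  by_cases h : p.1 n = 1
  · simp [bracketType, bracketMap, h]
  · simp [bracketType, bracketMap, fin_two_ne_one.1 h]

lemma bracketLabel_bracketMap (z : ℤ → Fin 2) (a : ℤ → Fin m) (n : ℤ) :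
    bracketLabel (bracketMap m (z, a) n) = a (onesCount z (openPos z n)) := by
  by_cases h : z n = 1
  · simp [bracketMap, openPos, h, bracketLabel]
  · simp [bracketMap, openPos, fin_two_ne_one.1 h, bracketLabel]

lemma Matched.dyckClass_block_eq_one (h : Matched (bracketType x) p q) (hx : x ∈ dyckShift m)
    (hinner : dyckClass (block x (p + 1) (q - 1)) = 1) :
    dyckClass (block x p q) = 1 ∧ bracketLabel (x p) = bracketLabel (x q) := by
  have hclass : dyckClass (block x p q) =
      dyckClass [Sum.inl (bracketLabel (x p)), Sum.inr (bracketLabel (x q))] := by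
    rw [block_eq_append_append x h.lt, dyckClass_append, dyckClass_append, hinner, mul_one,
      ← dyckClass_append, ← bracketType_eq_one_iff.1 h.opening,
      ← bracketType_ne_one_iff.1 h.closing]
    rfl
  have hlabel : bracketLabel (x p) = bracketLabel (x q) := by
    by_contra hne
    exact mem_dyckLanguage_iff.1 (hx p q h.lt.le) (hclass.trans (dyckClass_pair_of_ne hne))
  exact ⟨by rw [hclass, hlabel, dyckClass_pair_self], hlabel⟩

lemma Excursion.dyckClass_block_eq_one (h : Excursion (bracketType x) r l)
    (hx : x ∈ dyckShift m) : dyckClass (block x r (l - 1)) = 1 := by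
  induction hk : (l - r).toNat using Nat.strong_induction_on generalizing r l with
  | _ k ih =>
    rcases h.le.eq_or_lt with rfl | hrl
    · rw [block_of_lt x (sub_one_lt r), dyckClass_nil]
    · obtain ⟨p, hrp, hfirst, hmatched⟩ := h.exists_matched hrl
      have hpl := hmatched.lt
      have hlast := (hmatched.dyckClass_block_eq_one hx
        (ih _ (by omega) hmatched.inner_excursion rfl)).1
      rw [← block_append x hrp (by omega), dyckClass_append, hlast,
        ih _ (by omega) hfirst rfl, mul_one]

lemma Matched.bracketLabel_eq (h : Matched (bracketType x) p q) (hx : x ∈ dyckShift m) :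
    bracketLabel (x p) = bracketLabel (x q) :=
  (h.dyckClass_block_eq_one hx (h.inner_excursion.dyckClass_block_eq_one hx)).2

end Label

/-! ### Independent labels -/

section FactorsThroughOn

variable {α β γ δ : Type*}

/-- `b` takes equal values at any two points of `W` at which `f` does: the restriction to a set of
`Function.FactorsThrough`. -/
def FactorsThroughOn (b : α → β) (f : α → γ) (W : Set α) : Prop :=
  ∀ ⦃i⦄, i ∈ W → ∀ ⦃j⦄, j ∈ W → f i = f j → b i = b j

namespace FactorsThroughOn

variable {b b' : α → β} {f f' : α → γ} {W K : Set α}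

lemma exists_comp_eqOn [Nonempty β] (h : FactorsThroughOn b f W) :
    ∃ c : γ → β, Set.EqOn (c ∘ f) b W := by
  have hfactors : (W.domRestrict b).FactorsThrough (W.domRestrict f) := fun i j => h i.2 j.2
  exact ⟨Function.extend (W.domRestrict f) (W.domRestrict b) fun _ => Classical.arbitrary β,
    fun i hi => hfactors.extend_apply _ ⟨i, hi⟩⟩

lemma congr (h : FactorsThroughOn b f W) (hb : Set.EqOn b b' W) (hf : Set.EqOn f f' W) :
    FactorsThroughOn b' f' W := fun i hi j hj hij =>
  hb hi ▸ hb hj ▸ h hi hj (by rw [hf hi, hf hj, hij])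

lemma comp_iff {g : γ → δ} (hg : Set.InjOn g (f '' W)) :
    FactorsThroughOn b (g ∘ f) W ↔ FactorsThroughOn b f W :=
  ⟨fun h _ hi _ hj hij => h hi hj (congrArg g hij), fun h _ hi _ hj hij =>
    h hi hj (hg (Set.mem_image_of_mem f hi) (Set.mem_image_of_mem f hj) hij)⟩

lemma iff_of_mapsTo {f : α → α} (hK : Set.MapsTo f K K) (hKc : Set.MapsTo f Kᶜ Kᶜ) (hKW : K ⊆ W) :
    FactorsThroughOn b f W ↔ FactorsThroughOn b f K ∧ FactorsThroughOn b f (W \ K) := by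
  refine ⟨fun h => ⟨fun i hi j hj => h (hKW hi) (hKW hj), fun i hi j hj => h hi.1 hj.1⟩,
    fun ⟨hin, hout⟩ i hi j hj hij => ?_⟩
  by_cases hiK : i ∈ K <;> by_cases hjK : j ∈ K
  · exact hin hiK hjK hij
  · exact absurd (hij ▸ hK hiK) (hKc hjK)
  · exact absurd (hij ▸ hK hjK) (hKc hiK)
  · exact hout ⟨hi, hiK⟩ ⟨hj, hjK⟩ hij

end FactorsThroughOn

end FactorsThroughOn

section Labels

variable {k : ℕ} [NeZero k]

lemma symmetricProduct_cylinder (J : Finset ℤ) (c : ℤ → Fin k) :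
    symmetricProduct k {a | Set.EqOn a c J} = (k : ENNReal)⁻¹ ^ J.card := by
  have hpi : {a : ℤ → Fin k | Set.EqOn a c J} = Set.pi J fun j => {c j} := by
    ext a
    exact Iff.rfl
  rw [hpi, symmetricProduct, Measure.infinitePi_pi _ fun i _ => measurableSet_singleton _]
  simp only [uniformOfFintype_toMeasure_singleton, Fintype.card_fin, Finset.prod_const]

open Classical in
lemma symmetricProduct_comp_eqOn {ι : Type*} (W : Finset ι) (f : ι → ℤ) (b : ι → Fin k) :
    symmetricProduct k {a | Set.EqOn (a ∘ f) b W} =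
      if FactorsThroughOn b f W then (k : ENNReal)⁻¹ ^ (W.image f).card else 0 := by
  split_ifs with hb
  · obtain ⟨c, hc⟩ := hb.exists_comp_eqOn
    have himage : {a | Set.EqOn (a ∘ f) b W} = {a | Set.EqOn a c (W.image f)} := by
      ext a
      rw [Set.mem_ofPred_eq, Set.mem_ofPred_eq, Finset.coe_image,
        ← Set.eqOn_comp_right_iff]
      exact ⟨fun h => h.trans hc.symm, fun h => h.trans hc⟩
    rw [himage, symmetricProduct_cylinder]
  · have hempty : {a | Set.EqOn (a ∘ f) b W} = ∅ :=
      Set.eq_empty_of_forall_notMem fun a ha => hb fun i hi j hj hij => by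
        rw [← ha hi, ← ha hj, Function.comp_apply, Function.comp_apply, hij]
    rw [hempty, measure_empty]

lemma injOn_onesCount_image_openPos {z : ℤ → Fin 2} (hz : z ∈ balancedSet) (W : Set ℤ) :
    Set.InjOn (onesCount z) (openPos z '' W) :=
  (strictMonoOn_onesCount z).injOn.mono <| by
    rintro _ ⟨n, -, rfl⟩
    exact apply_openPos hz n

open Classical in
lemma symmetricProduct_label_eqOn {z : ℤ → Fin 2} (hz : z ∈ balancedSet) (W : Finset ℤ)
    (b : ℤ → Fin k) :
    symmetricProduct k {a | Set.EqOn (a ∘ onesCount z ∘ openPos z) b W} =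
      if FactorsThroughOn b (openPos z) W then (k : ENNReal)⁻¹ ^ (W.image (openPos z)).card
      else 0 := by
  have hinj := injOn_onesCount_image_openPos hz W
  rw [symmetricProduct_comp_eqOn, FactorsThroughOn.comp_iff hinj, ← Finset.image_image,
    Finset.card_image_of_injOn (by rwa [Finset.coe_image])]

end Labels

/-! ### Exchanging well-bracketed words -/

section Exchange

/-- The positions `[r, l)` of a bracket sequence with types `z` and labels `b` carry a
well-bracketed word: the brackets are matched among themselves, with equal labels. -/
structure IsWellBracketed {β : Type*} (z : ℤ → Fin 2) (b : ℤ → β) (r l : ℤ) : Prop where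
  excursion : Excursion z r l
  factorsThroughOn : FactorsThroughOn b (openPos z) (Set.Ico r l)

/-- `y` is obtained from `x` by replacing a well-bracketed word at the positions `[r, l)` by another
one. -/
structure ExchangeRel {m : ℕ} (r l : ℤ) (x y : ℤ → DyckAlphabet m) : Prop where
  left : IsWellBracketed (bracketType x) (bracketLabel ∘ x) r l
  right : IsWellBracketed (bracketType y) (bracketLabel ∘ y) r l
  eqOn : Set.EqOn x y (Set.Ico r l)ᶜ

variable {m k : ℕ} {r l : ℤ} {z z' : ℤ → Fin 2} {W : Finset ℤ}

namespace Excursion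

lemma mapsTo_openPos (h : Excursion z r l) :
    Set.MapsTo (openPos z) (Set.Ico r l) (Set.Ico r l) := fun _ => h.openPos_mem

lemma mapsTo_openPos_compl (h : Excursion z r l) (hz : z ∈ balancedSet) :
    Set.MapsTo (openPos z) (Set.Ico r l)ᶜ (Set.Ico r l)ᶜ := fun _ => h.openPos_notMem hz

lemma isWellBracketed {x : ℤ → DyckAlphabet m} (h : Excursion (bracketType x) r l)
    (hx : x ∈ dyckShift m) : IsWellBracketed (bracketType x) (bracketLabel ∘ x) r l := by
  refine ⟨h, fun i hi j hj hij => ?_⟩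
  have hlabel {n : ℤ} (hn : n ∈ Set.Ico r l) :
      bracketLabel (x (openPos (bracketType x) n)) = bracketLabel (x n) := by
    by_cases hn1 : bracketType x n = 1
    · rw [openPos_of_one hn1]
    · exact (h.matched_openPos hn hn1).1.bracketLabel_eq hx
  rw [Function.comp_apply, Function.comp_apply, ← hlabel hi, ← hlabel hj, hij]

lemma two_mul_card_image_openPos_of_subset (h : Excursion z r l) (hz : z ∈ balancedSet)
    (hW : Finset.Ico r l ⊆ W) :
    (2 * (W.image (openPos z)).card : ℤ) =
      l - r + 2 * ((W \ Finset.Ico r l).image (openPos z)).card := by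
  have hdisj : Disjoint ((Finset.Ico r l).image (openPos z))
      ((W \ Finset.Ico r l).image (openPos z)) := by
    rw [← Finset.disjoint_coe, Finset.coe_image, Finset.coe_image, Finset.coe_sdiff,
      Finset.coe_Ico]
    exact disjoint_compl_right.mono h.mapsTo_openPos.image_subset
      ((h.mapsTo_openPos_compl hz).mono_left fun _ hn => hn.2).image_subset
  have hcard := h.two_mul_card_image_openPos
  rw [← Finset.union_sdiff_of_subset hW, Finset.image_union, Finset.card_union_of_disjoint hdisj,
    Finset.union_sdiff_of_subset hW]
  push_cast
  omega

lemma card_image_openPos_congr (h : Excursion z r l) (h' : Excursion z' r l)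
    (hz : z ∈ balancedSet) (hz' : z' ∈ balancedSet) (hzz : Set.EqOn z z' (Set.Ico r l)ᶜ)
    (hW : Finset.Ico r l ⊆ W) :
    (W.image (openPos z')).card = (W.image (openPos z)).card := by
  have hout : (W \ Finset.Ico r l).image (openPos z') = (W \ Finset.Ico r l).image (openPos z) :=
    Finset.image_congr fun n hn => h.openPos_congr_outside h' hzz hz fun hmem =>
      (Finset.mem_sdiff.1 hn).2 (Finset.mem_Ico.2 hmem)
  have hcard := h.two_mul_card_image_openPos_of_subset hz hW
  have hcard' := h'.two_mul_card_image_openPos_of_subset hz' hW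
  rw [hout] at hcard'
  omega

end Excursion

namespace IsWellBracketed

lemma congr {β : Type*} {b b' : ℤ → β} (h : IsWellBracketed z b r l)
    (hz : Set.EqOn z z' (Set.Ico r l)) (hb : Set.EqOn b b' (Set.Ico r l)) :
    IsWellBracketed z' b' r l :=
  ⟨h.excursion.congr hz, h.factorsThroughOn.congr hb fun _ hn =>
    (h.excursion.openPos_congr hz hn).symm⟩

lemma factorsThroughOn_congr {β : Type*} {b b' : ℤ → β} {W : Set ℤ} (h : IsWellBracketed z b r l)
    (h' : IsWellBracketed z' b' r l) (hz : z ∈ balancedSet) (hz' : z' ∈ balancedSet)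
    (hzz : Set.EqOn z z' (Set.Ico r l)ᶜ) (hbb : Set.EqOn b b' (Set.Ico r l)ᶜ)
    (hW : Set.Ico r l ⊆ W) :
    FactorsThroughOn b (openPos z) W ↔ FactorsThroughOn b' (openPos z') W := by
  have hpos : Set.EqOn (openPos z) (openPos z') (W \ Set.Ico r l) := fun n hn =>
    (h.excursion.openPos_congr_outside h'.excursion hzz hz hn.2).symm
  have hb : Set.EqOn b b' (W \ Set.Ico r l) := hbb.mono fun _ hn => hn.2
  rw [FactorsThroughOn.iff_of_mapsTo h.excursion.mapsTo_openPos
      (h.excursion.mapsTo_openPos_compl hz) hW,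
    FactorsThroughOn.iff_of_mapsTo h'.excursion.mapsTo_openPos
      (h'.excursion.mapsTo_openPos_compl hz') hW]
  exact and_congr (iff_of_true h.factorsThroughOn h'.factorsThroughOn)
    ⟨fun hout => hout.congr hb hpos, fun hout => hout.congr hb.symm hpos.symm⟩

lemma symmetricProduct_label_eqOn_congr [NeZero k] {b b' : ℤ → Fin k}
    (h : IsWellBracketed z b r l) (h' : IsWellBracketed z' b' r l)
    (hz : z ∈ balancedSet) (hz' : z' ∈ balancedSet) (hzz : Set.EqOn z z' (Set.Ico r l)ᶜ)
    (hbb : Set.EqOn b b' (Set.Ico r l)ᶜ) (hW : Finset.Ico r l ⊆ W) :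
    symmetricProduct k {a | Set.EqOn (a ∘ onesCount z ∘ openPos z) b W} =
      symmetricProduct k {a | Set.EqOn (a ∘ onesCount z' ∘ openPos z') b' W} := by
  classical
  rw [symmetricProduct_label_eqOn hz, symmetricProduct_label_eqOn hz',
    h.factorsThroughOn_congr h' hz hz' hzz hbb (by rwa [← Finset.coe_Ico, Finset.coe_subset]),
    h.excursion.card_image_openPos_congr h'.excursion hz hz' hzz hW]

end IsWellBracketed

end Exchange

/-! ### The measure of a cylinder -/

section Cylinder

lemma measurableSet_setOf_eqOn {ι S : Type*} [MeasurableSpace S] [MeasurableSingletonClass S]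
    {W : Set ι} (hW : W.Countable) (u : ι → S) : MeasurableSet {t : ι → S | Set.EqOn t u W} := by
  have hpi : {t : ι → S | Set.EqOn t u W} = Set.pi W fun n => {u n} := by
    ext t
    exact Iff.rfl
  rw [hpi]
  exact MeasurableSet.pi hW fun n _ => measurableSet_singleton _

lemma map_uniformOfFintype_toMeasure {α : Type*} [Fintype α] [Nonempty α] [MeasurableSpace α]
    [MeasurableSingletonClass α] (σ : Equiv.Perm α) :
    (PMF.uniformOfFintype α).toMeasure.map σ = (PMF.uniformOfFintype α).toMeasure := by
  refine Measure.ext_of_singleton fun a => ?_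
  have hpreimage : σ ⁻¹' {a} = {σ.symm a} := by
    ext b
    exact σ.eq_symm_apply.symm
  rw [Measure.map_apply (measurable_of_countable _) (measurableSet_singleton a), hpreimage,
    uniformOfFintype_toMeasure_singleton, uniformOfFintype_toMeasure_singleton]

lemma measurePreserving_perm_symmetricProduct {k : ℕ} [NeZero k] (σ : ℤ → Equiv.Perm (Fin k)) :
    MeasurePreserving (fun z n => σ n (z n)) (symmetricProduct k) (symmetricProduct k) := by
  refine ⟨measurable_pi_lambda _ fun n =>
    (measurable_of_countable (σ n)).comp (measurable_pi_apply n), ?_⟩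
  have hmap := Measure.infinitePi_map_pi
    (fun _ : ℤ => (PMF.uniformOfFintype (Fin k)).toMeasure) (f := fun n => σ n)
    fun n => measurable_of_countable _
  simp only [map_uniformOfFintype_toMeasure] at hmap
  exact hmap

instance instMeasurableSingletonClassSum {α β : Type*} [MeasurableSpace α] [MeasurableSpace β]
    [MeasurableSingletonClass α] [MeasurableSingletonClass β] :
    MeasurableSingletonClass (α ⊕ β) where
  measurableSet_singleton _ := measurableSet_sum_iff.2
    ⟨(Set.subsingleton_singleton.preimage Sum.inl_injective).measurableSet,
      (Set.subsingleton_singleton.preimage Sum.inr_injective).measurableSet⟩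

variable {m : ℕ}

lemma measurable_bracketType : Measurable (bracketType (m := m)) :=
  measurable_pi_lambda _ fun n =>
    (measurable_of_countable fun c : DyckAlphabet m => if c.isLeft then (1 : Fin 2) else 0).comp
      (measurable_pi_apply n)

lemma measurable_bracketMap : Measurable (bracketMap m) :=
  measurable_pi_lambda _ fun n => Measurable.ite
    ((measurable_pi_apply n).comp measurable_fst (measurableSet_singleton 1))
    (measurable_inl.comp (measurable_apply_index (f := Prod.snd)
      (fun i => (measurable_pi_apply i).comp measurable_snd)
      ((measurable_onesCount n).comp measurable_fst)))
    (measurable_inr.comp (measurable_apply_index (f := Prod.snd)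
      (fun i => (measurable_pi_apply i).comp measurable_snd)
      ((measurable_apply_index measurable_onesCount (measurable_matchPos n)).comp
        measurable_fst)))

lemma bracketMap_eqOn_iff {z : ℤ → Fin 2} {a : ℤ → Fin m} {u : ℤ → DyckAlphabet m} {W : Set ℤ} :
    Set.EqOn (bracketMap m (z, a)) u W ↔ Set.EqOn z (bracketType u) W ∧
      Set.EqOn (a ∘ onesCount z ∘ openPos z) (bracketLabel ∘ u) W := by
  simp only [Set.EqOn, eq_iff_bracketType_bracketLabel, bracketType_bracketMap,
    bracketLabel_bracketMap, Function.comp_apply]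
  exact forall₂_and

variable [NeZero m]

lemma dyckMeasure_eq_map :
    dyckMeasure m = ((symmetricProduct 2).prod (symmetricProduct m)).map (bracketMap m) := by
  rw [dyckMeasure, Measure.restrict_eq_self_of_ae_mem]
  filter_upwards [Measure.quasiMeasurePreserving_fst.ae ae_mem_balancedSet] with p hp
  exact ⟨hp, trivial⟩

instance dyckMeasure.instIsProbabilityMeasure : IsProbabilityMeasure (dyckMeasure m) := by
  rw [dyckMeasure_eq_map]
  exact Measure.isProbabilityMeasure_map measurable_bracketMap.aemeasurable

lemma dyckMeasure_dyckShift : dyckMeasure m (dyckShift m) = 1 := by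
  refine le_antisymm prob_le_one ?_
  have huniv : bracketMap m ⁻¹' dyckShift m = Set.univ :=
    Set.eq_univ_of_forall bracketMap_mem_dyckShift
  calc 1 = ((symmetricProduct 2).prod (symmetricProduct m)) (bracketMap m ⁻¹' dyckShift m) := by
        rw [huniv, measure_univ]
    _ ≤ dyckMeasure m (dyckShift m) := by
        rw [dyckMeasure_eq_map]
        exact Measure.le_map_apply measurable_bracketMap.aemeasurable _

lemma dyckMeasure_apply {s : Set (ℤ → DyckAlphabet m)} (hs : MeasurableSet s) :
    dyckMeasure m s =
      ∫⁻ z, symmetricProduct m {a | bracketMap m (z, a) ∈ s} ∂symmetricProduct 2 := by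
  rw [dyckMeasure_eq_map, Measure.map_apply measurable_bracketMap hs,
    Measure.prod_apply (measurable_bracketMap hs)]
  rfl

lemma ae_bracketType_mem_balancedSet : ∀ᵐ x ∂dyckMeasure m, bracketType x ∈ balancedSet := by
  rw [dyckMeasure_eq_map, ae_map_iff measurable_bracketMap.aemeasurable
    (measurable_bracketType measurableSet_balancedSet)]
  filter_upwards [Measure.quasiMeasurePreserving_fst.ae ae_mem_balancedSet] with p hp
  rwa [bracketType_bracketMap]

namespace ExchangeRel

variable {r l : ℤ} {u v : ℤ → DyckAlphabet m} {W : Finset ℤ}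

lemma symmetricProduct_bracketMap_eqOn {z z' : ℤ → Fin 2} (h : ExchangeRel r l u v)
    (hW : Finset.Ico r l ⊆ W) (hz : z ∈ balancedSet) (hz' : z' ∈ balancedSet)
    (hzz : Set.EqOn z z' (Set.Ico r l)ᶜ)
    (htype : ∀ n, z n = bracketType u n ↔ z' n = bracketType v n) :
    symmetricProduct m {a | Set.EqOn (bracketMap m (z, a)) u W} =
      symmetricProduct m {a | Set.EqOn (bracketMap m (z', a)) v W} := by
  have htypeW : Set.EqOn z (bracketType u) W ↔ Set.EqOn z' (bracketType v) W :=
    forall₂_congr fun n _ => htype n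
  simp only [bracketMap_eqOn_iff]
  by_cases hu : Set.EqOn z (bracketType u) W
  · have hv := htypeW.1 hu
    have hWIco : Set.Ico r l ⊆ W := by rwa [← Finset.coe_Ico, Finset.coe_subset]
    simp only [hu, hv, true_and]
    exact (h.left.congr (hu.symm.mono hWIco) fun _ _ => rfl).symmetricProduct_label_eqOn_congr
      (h.right.congr (hv.symm.mono hWIco) fun _ _ => rfl) hz hz' hzz
      (fun n hn => congrArg bracketLabel (h.eqOn hn)) hW
  · simp only [hu, htypeW.not.1 hu, false_and]

/-- Swapping the types of `u` and `v` at each position preserves the law of the bracket types and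
maps the first cylinder onto the second. -/
lemma dyckMeasure_cylinder_eq (h : ExchangeRel r l u v) (hW : Finset.Ico r l ⊆ W) :
    dyckMeasure m {t | Set.EqOn t u W} = dyckMeasure m {t | Set.EqOn t v W} := by
  have hmeas (w : ℤ → DyckAlphabet m) := measurableSet_setOf_eqOn W.countable_toSet w
  rw [dyckMeasure_apply (hmeas u), dyckMeasure_apply (hmeas v)]
  let σ (n : ℤ) : Equiv.Perm (Fin 2) := Equiv.swap (bracketType u n) (bracketType v n)
  have hσ := measurePreserving_perm_symmetricProduct σ
  have hfiber : Measurable fun z =>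
      symmetricProduct m {a | bracketMap m (z, a) ∈ {t | Set.EqOn t v W}} :=
    measurable_measure_prodMk_left (measurable_bracketMap (hmeas v))
  rw [← hσ.lintegral_comp hfiber]
  refine lintegral_congr_ae ?_
  filter_upwards [ae_mem_balancedSet, hσ.quasiMeasurePreserving.ae ae_mem_balancedSet]
    with z hz hσz
  refine h.symmetricProduct_bracketMap_eqOn hW hz hσz (fun n hn => ?_) fun n => ?_
  · simp only [σ, bracketType_congr (h.eqOn hn), Equiv.swap_self, Equiv.refl_apply]
  · rw [Equiv.swap_apply_eq_iff, Equiv.swap_apply_right]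

end ExchangeRel

end Cylinder

/-! ### Replacing words in Borel sets -/

/-- Measurable subsets of `A` are mapped by `g` to measurable sets of the same measure. -/
def PreservesMeasureOn {Ω : Type*} [MeasurableSpace Ω] (μ : Measure Ω) (g : Ω → Ω) (A : Set Ω) :
    Prop :=
  ∀ ⦃B⦄, B ⊆ A → MeasurableSet B → MeasurableSet (g '' B) ∧ μ (g '' B) = μ B

/-- Replacing the word of `x` at the coordinates in `K` by the word of `y` does not change the
measure `μ` of any cylinder set that fixes these coordinates. -/
def IsExchangeableOn {ι S : Type*} [DecidableEq ι] [MeasurableSpace S] (μ : Measure (ι → S))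
    (K : Finset ι) (x y : ι → S) : Prop :=
  ∀ W : Finset ι, K ⊆ W → ∀ w,
    μ {t | Set.EqOn t (K.piecewise x w) W} = μ {t | Set.EqOn t (K.piecewise y w) W}

section Replacement

variable {ι S : Type*}

lemma piecewise_eqOn_and_eqOn_iff [DecidableEq ι] {I K : Finset ι} {x y w : ι → S}
    (hw : Set.EqOn x w (I ∩ K)) (t : ι → S) :
    Set.EqOn (K.piecewise x t) w I ∧ Set.EqOn t y K ↔
      Set.EqOn t (K.piecewise y w) (I ∪ K : Finset ι) := by
  constructor
  · rintro ⟨hI, hK⟩ n hn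
    by_cases hnK : n ∈ K
    · simpa only [Finset.piecewise_eq_of_mem _ _ _ hnK] using hK hnK
    · simpa only [Finset.piecewise_eq_of_notMem _ _ _ hnK] using
        hI ((Finset.mem_union.1 hn).resolve_right hnK)
  · refine fun h => ⟨fun n hn => ?_, fun n hn => ?_⟩
    · by_cases hnK : n ∈ K
      · simpa only [Finset.piecewise_eq_of_mem _ _ _ hnK] using hw ⟨hn, hnK⟩
      · simpa only [Finset.piecewise_eq_of_notMem _ _ _ hnK] using h (Finset.mem_union_left K hn)
    · simpa only [Finset.piecewise_eq_of_mem _ _ _ hn] using h (Finset.mem_union_right I hn)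

lemma piecewise_eq_of_eqOn [DecidableEq ι] {K : Finset ι} {x t : ι → S} (h : Set.EqOn t x K) :
    K.piecewise x t = t := by
  refine funext fun n => ?_
  by_cases hn : n ∈ K
  · rw [Finset.piecewise_eq_of_mem _ _ _ hn, h hn]
  · rw [Finset.piecewise_eq_of_notMem _ _ _ hn]

lemma image_piecewise_eq [DecidableEq ι] {K : Finset ι} {x : ι → S} {B : Set (ι → S)}
    (hB : B ⊆ {t | Set.EqOn t x K}) (y : ι → S) :
    (fun t => K.piecewise y t) '' B =
      (fun t => K.piecewise x t) ⁻¹' B ∩ {t | Set.EqOn t y K} := by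
  ext s
  constructor
  · rintro ⟨t, ht, rfl⟩
    have hback : K.piecewise x (K.piecewise y t) = t := by
      rw [Finset.piecewise_idem_right]
      exact piecewise_eq_of_eqOn (hB ht)
    refine ⟨by rwa [Set.mem_preimage, hback], fun n hn => Finset.piecewise_eq_of_mem _ _ _ hn⟩
  · rintro ⟨hs, hsy⟩
    exact ⟨_, hs, (K.piecewise_idem_right y x s).trans (piecewise_eq_of_eqOn hsy)⟩

variable [MeasurableSpace S]

lemma measurable_piecewise_left [DecidableEq ι] (K : Finset ι) (x : ι → S) :
    Measurable fun t => K.piecewise x t := by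
  refine measurable_pi_lambda _ fun n => ?_
  by_cases hn : n ∈ K
  · simp only [Finset.piecewise_eq_of_mem _ _ _ hn, measurable_const]
  · simpa only [Finset.piecewise_eq_of_notMem _ _ _ hn] using measurable_pi_apply n

variable [MeasurableSingletonClass S] [Countable S] {μ ν : Measure (ι → S)} [IsFiniteMeasure μ]

lemma measure_ext_of_cylinders
    (h : ∀ (I : Finset ι) (w : ι → S), μ {t | Set.EqOn t w I} = ν {t | Set.EqOn t w I}) :
    μ = ν := by
  have hfinite (I : Finset ι) : IsFiniteMeasure (μ.map I.restrict) := inferInstance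
  refine IsProjectiveLimit.unique (P := fun I : Finset ι => μ.map I.restrict) (fun _ => rfl)
    fun I => Measure.ext_of_singleton fun c => ?_
  rw [Measure.map_apply (Finset.measurable_restrict I) (measurableSet_singleton c),
    Measure.map_apply (Finset.measurable_restrict I) (measurableSet_singleton c)]
  rcases (I.restrict ⁻¹' {c} : Set (ι → S)).eq_empty_or_nonempty with hempty | ⟨w, rfl⟩
  · rw [hempty, measure_empty, measure_empty]
  · have hcylinder : (I.restrict ⁻¹' {I.restrict w} : Set (ι → S)) = {t | Set.EqOn t w I} := by
      ext t
      simp only [Set.mem_preimage, Set.mem_singleton_iff, funext_iff, Finset.restrict,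
        Subtype.forall]
      exact Iff.rfl
    rw [hcylinder, h]

variable [DecidableEq ι] {K : Finset ι} {x y : ι → S}

lemma map_piecewise_restrict_eq (hμ : IsExchangeableOn μ K x y) :
    (μ.restrict {t | Set.EqOn t x K}).map (fun t => K.piecewise x t) =
      (μ.restrict {t | Set.EqOn t y K}).map (fun t => K.piecewise x t) := by
  refine measure_ext_of_cylinders fun I w => ?_
  have hI := measurableSet_setOf_eqOn I.countable_toSet w
  have hx := measurable_piecewise_left K x
  rw [Measure.map_apply hx hI, Measure.map_apply hx hI, Measure.restrict_apply (hx hI),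
    Measure.restrict_apply (hx hI)]
  by_cases hw : Set.EqOn x w (I ∩ K)
  · have hinter (y : ι → S) :
        (fun t => K.piecewise x t) ⁻¹' {t | Set.EqOn t w I} ∩ {t | Set.EqOn t y K} =
          {t | Set.EqOn t (K.piecewise y w) (I ∪ K : Finset ι)} :=
      Set.ext fun t => piecewise_eqOn_and_eqOn_iff hw t
    rw [hinter, hinter, hμ _ Finset.subset_union_right]
  · have hempty : (fun t => K.piecewise x t) ⁻¹' {t | Set.EqOn t w I} = ∅ :=
      Set.eq_empty_of_forall_notMem fun t ht => hw fun n hn => by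
        exact (K.piecewise_eq_of_mem x t hn.2).symm.trans (ht hn.1)
    rw [hempty, Set.empty_inter, Set.empty_inter]

lemma preservesMeasureOn_piecewise (hμ : IsExchangeableOn μ K x y) :
    PreservesMeasureOn μ (fun t => K.piecewise y t) {t | Set.EqOn t x K} := by
  intro B hBx hB
  have hx := measurable_piecewise_left K x
  have himage (y : ι → S) : μ ((fun t => K.piecewise y t) '' B) =
      (μ.restrict {t | Set.EqOn t y K}).map (fun t => K.piecewise x t) B := by
    rw [Measure.map_apply hx hB, Measure.restrict_apply (hx hB), image_piecewise_eq hBx]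
  have hself : (fun t => K.piecewise x t) '' B = B :=
    (Set.image_congr fun t ht => piecewise_eq_of_eqOn (hBx ht)).trans (Set.image_id B)
  refine ⟨?_, ?_⟩
  · rw [image_piecewise_eq hBx]
    exact (hx hB).inter (measurableSet_setOf_eqOn K.countable_toSet y)
  · rw [himage, ← map_piecewise_restrict_eq hμ, ← himage, hself]

end Replacement

/-! ### Eventually periodic stacks of open brackets -/

section PeriodicStack

lemma symmetricProduct_forall_comp_eq {k : ℕ} [NeZero k] (hk : 1 < k) {e : ℕ → ℤ}
    (he : Function.Injective e) (v : Fin k) :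
    symmetricProduct k {a | ∀ t, a (e t) = v} = 0 := by
  have hlt : (k : ENNReal)⁻¹ < 1 := ENNReal.inv_lt_one.2 (by exact_mod_cast hk)
  refine le_antisymm (ge_of_tendsto' (ENNReal.tendsto_pow_atTop_nhds_zero_of_lt_one hlt)
    fun T => ?_) bot_le
  have hcard : ((Finset.range T).image e).card = T := by
    rw [Finset.card_image_of_injective _ he, Finset.card_range]
  conv_rhs => rw [← hcard, ← symmetricProduct_cylinder _ fun _ => v]
  refine measure_mono fun a ha n hn => ?_
  obtain ⟨t, -, rfl⟩ := Finset.mem_image.1 (Finset.mem_coe.1 hn)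
  exact ha t

lemma symmetricProduct_periodic_comp_eq_zero {k : ℕ} [NeZero k] (hk : 1 < k) {e : ℤ → ℤ}
    {h₀ : ℤ} (he : Set.InjOn e (Set.Iic h₀)) {d : ℕ} (hd : 0 < d) :
    symmetricProduct k {a | ∀ h ≤ h₀, a (e (h - d)) = a (e h)} = 0 := by
  let f : ℕ → ℤ := fun t => h₀ - t * d
  have hf (t : ℕ) : f t ≤ h₀ := sub_le_self _ (by positivity)
  have hfinj : Function.Injective f := fun s t hst => by
    have hst : (s : ℤ) * d = t * d := sub_right_injective hst
    exact_mod_cast mul_right_cancel₀ (Int.natCast_ne_zero.2 hd.ne') hst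
  have hinj : Function.Injective (e ∘ f) := fun s t hst => hfinj (he (hf s) (hf t) hst)
  refine measure_mono_null (fun a ha => ?_)
    (measure_iUnion_null fun v => symmetricProduct_forall_comp_eq hk hinj v)
  refine Set.mem_iUnion.2 ⟨a (e h₀), fun t => ?_⟩
  induction t with
  | zero => simp [f]
  | succ t ih =>
    have hsucc : f (t + 1) = f t - d := by simp only [f]; push_cast; ring
    rw [Function.comp_apply, hsucc, ha _ (hf t), ← ih, Function.comp_apply]

variable {m : ℕ}

/-- The label of the bracket that is the last to be opened at the height `h` before the origin. For
negative `h` these are the brackets that are still open at the origin and thus form its stack. -/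
noncomputable def stackLabel (x : ℤ → DyckAlphabet m) (h : ℤ) : Fin m :=
  bracketLabel (x (lastBelow (bracketType x) 0 h))

/-- The points whose stack of open brackets at the origin is periodic from some depth on. -/
def periodicStackSet (m : ℕ) : Set (ℤ → DyckAlphabet m) :=
  {x | ∃ d : ℕ, 0 < d ∧ ∃ h₀ : ℤ, ∀ h ≤ h₀, stackLabel x (h - d) = stackLabel x h}

lemma mem_periodicStackSet_of_shift {x : ℤ → DyckAlphabet m} {h₀ d : ℤ} (hd : d ≠ 0)
    (hx : ∀ h ≤ h₀, h + d ≤ h₀ → stackLabel x h = stackLabel x (h + d)) :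
    x ∈ periodicStackSet m := by
  refine ⟨d.natAbs, Int.natAbs_pos.2 hd, h₀, fun h hh => ?_⟩
  rcases hd.lt_or_gt with hd | hd
  · have hsub : h - d.natAbs = h + d := by omega
    rw [hsub, hx h hh (by omega)]
  · have hsub : h - d.natAbs + d = h := by omega
    rw [hx (h - d.natAbs) (by omega) (by omega), hsub]

lemma measurable_stackLabel (h : ℤ) : Measurable fun x : ℤ → DyckAlphabet m => stackLabel x h :=
  (measurable_of_countable bracketLabel).comp <| measurable_apply_index (fun n =>
    measurable_pi_apply n) ((measurable_lastBelow 0 h).comp measurable_bracketType)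

lemma measurableSet_periodicStackSet : MeasurableSet (periodicStackSet m) := by
  refine measurableSet_setOfPred.2 <| Measurable.exists fun d => measurable_const.and <|
    Measurable.exists fun h₀ => Measurable.forall fun h => measurable_const.imp ?_
  exact measurableSet_setOfPred.1
    (measurableSet_eq_fun (measurable_stackLabel (h - d)) (measurable_stackLabel h))

section BracketMap

variable {z : ℤ → Fin 2} {h : ℤ}

lemma stackLabel_bracketMap (hz : z ∈ balancedSet) (a : ℤ → Fin m) (hh : h < 0) :
    stackLabel (bracketMap m (z, a)) h = a (onesCount z (lastBelow z 0 h)) := by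
  have hopening := apply_lastBelow (exists_lt_height_le hz 0 h) (by rwa [height_zero])
  rw [stackLabel, bracketType_bracketMap, bracketLabel_bracketMap, openPos_of_one hopening]

lemma injOn_onesCount_lastBelow (hz : z ∈ balancedSet) :
    Set.InjOn (fun h => onesCount z (lastBelow z 0 h)) (Set.Iio 0) := by
  have hlow {h : ℤ} (hh : h < 0) : h < height z 0 := by rwa [height_zero]
  refine (strictMonoOn_onesCount z).injOn.comp (fun h hh h' hh' heq => ?_)
    fun h hh => apply_lastBelow (exists_lt_height_le hz 0 h) (hlow hh)
  rw [← height_lastBelow (exists_lt_height_le hz 0 h) (hlow hh), heq,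
    height_lastBelow (exists_lt_height_le hz 0 h') (hlow hh')]

end BracketMap

lemma symmetricProduct_bracketMap_mem_periodicStackSet [NeZero m] (hm : 1 < m) {z : ℤ → Fin 2}
    (hz : z ∈ balancedSet) :
    symmetricProduct m {a | bracketMap m (z, a) ∈ periodicStackSet m} = 0 := by
  have hnull (d : ℕ) (hd : 0 < d) (h₀ : ℤ) := symmetricProduct_periodic_comp_eq_zero hm
    ((injOn_onesCount_lastBelow hz).mono fun h (hh : h ≤ min h₀ (-1)) =>
      Set.mem_Iio.2 (by omega)) hd
  refine measure_mono_null (fun a ha => ?_) (measure_iUnion_null fun d : ℕ =>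
    measure_iUnion_null fun hd : 0 < d => measure_iUnion_null fun h₀ => hnull d hd h₀)
  obtain ⟨d, hd, h₀, hper⟩ := ha
  simp only [Set.mem_iUnion]
  refine ⟨d, hd, h₀, fun h hh => ?_⟩
  rw [← stackLabel_bracketMap hz a (by omega), ← stackLabel_bracketMap hz a (by omega)]
  exact hper h (hh.trans (min_le_left _ _))

lemma dyckMeasure_periodicStackSet [NeZero m] (hm : 1 < m) :
    dyckMeasure m (periodicStackSet m) = 0 := by
  rw [dyckMeasure_apply measurableSet_periodicStackSet, lintegral_eq_zero_of_ae_eq_zero]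
  filter_upwards [ae_mem_balancedSet] with z hz
  exact symmetricProduct_bracketMap_mem_periodicStackSet hm hz

end PeriodicStack

/-! ### Double-tail equivalent points -/

section DoubleTail

lemma DoubleTail.symm {S : Type*} {X : Set (ℤ → S)} {x y : ℤ → S} (h : DoubleTail X x y) :
    DoubleTail X y x :=
  let ⟨hx, hy, n, hn⟩ := h
  ⟨hy, hx, n, fun k hk => (hn k hk).symm⟩

variable {z z' : ℤ → Fin 2} {p q p' q' k M N c₁ c₂ : ℤ}

/-- Left of `M` the heights of `z'` are those of `z` plus `c₁`, right of `N` they are those of `z`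
plus `c₂`: the heights of two sequences that agree outside of `[M, N)` are related in this way. -/
structure HeightOffset (z z' : ℤ → Fin 2) (M N c₁ c₂ : ℤ) : Prop where
  le : M ≤ N
  left : ∀ j ≤ M, height z' j = height z j + c₁
  right : ∀ j ≥ N, height z' j = height z j + c₂

lemma exists_heightOffset (hMN : M ≤ N) (h : Set.EqOn z z' (Set.Ico M N)ᶜ) :
    ∃ c₁ c₂, HeightOffset z z' M N c₁ c₂ := by
  refine ⟨height z' M - height z M, height z' N - height z N, hMN, fun j hj => ?_, fun j hj => ?_⟩
  · have := height_sub_congr (z := z) (z' := z') hj fun i hi => h fun hi' => hi.2.not_ge hi'.1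
    omega
  · have := height_sub_congr (z := z) (z' := z') hj fun i hi => h fun hi' => hi'.2.not_ge hi.1
    omega

lemma exists_forall_lt_height (z : ℤ → Fin 2) (M N : ℤ) :
    ∃ k, ∀ j ∈ Set.Icc M N, k < height z j := by
  obtain ⟨b, hb⟩ := ((Set.finite_Icc M N).image (height z)).bddBelow
  exact ⟨b - 1, fun j hj => (sub_one_lt b).trans_le (hb (Set.mem_image_of_mem _ hj))⟩

lemma exists_forall_lt_height_and_lt_height (z z' : ℤ → Fin 2) (M N c : ℤ) :
    ∃ k, ∀ j ∈ Set.Icc M N, k < height z j ∧ k + c < height z' j := by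
  obtain ⟨k, hk⟩ := exists_forall_lt_height z M N
  obtain ⟨k', hk'⟩ := exists_forall_lt_height z' M N
  refine ⟨min k (k' - c), fun j hj => ⟨(min_le_left _ _).trans_lt (hk j hj), ?_⟩⟩
  exact (le_sub_iff_add_le.1 (min_le_right _ _)).trans_lt (hk' j hj)

lemma exists_matched_of_opening (hz : z ∈ balancedSet) (hp : z p = 1) : ∃ q, Matched z p q := by
  obtain ⟨l, ⟨hpl, hl⟩, hleast⟩ := Int.exists_least_of_bdd
    (P := fun l => p < l ∧ height z l ≤ height z p) ⟨p, fun _ h => h.1.le⟩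
    (exists_gt_height_le hz p (height z p))
  have hlt (j : ℤ) (hpj : p < j) (hjl : j < l) : height z p < height z j :=
    not_le.1 fun hj => (hleast j ⟨hpj, hj⟩).not_gt hjl
  have hne : l ≠ p + 1 := by
    rintro rfl
    have := height_succ_of_one hp
    omega
  have hprev := hlt (l - 1) (by omega) (sub_one_lt l)
  have hstep := height_le_height_succ_add_one z (l - 1)
  rw [sub_add_cancel] at hstep
  refine ⟨l - 1, by omega, ?_, fun j hpj hj => hlt j hpj (by omega)⟩
  rw [sub_add_cancel]
  omega

lemma exists_matched_lastBelow (hz : z ∈ balancedSet) (hMN : M ≤ N)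
    (hk : ∀ j ∈ Set.Icc M N, k < height z j) : ∃ q ≥ N, Matched z (lastBelow z M k) q := by
  have hex := exists_lt_height_le hz M k
  have hM := hk M ⟨le_rfl, hMN⟩
  obtain ⟨q, hq⟩ := exists_matched_of_opening hz (apply_lastBelow hex hM)
  have hheight := hq.height_eq.trans (height_lastBelow hex hM)
  have hlast := (isGreatest_lastBelow hex).2
  refine ⟨q, not_lt.1 fun hqN => ?_, hq⟩
  rcases lt_or_ge (q + 1) M with hqM | hMq
  · exact (hq.lt.trans (Int.lt_succ q)).not_ge (hlast ⟨hqM, hheight.le⟩)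
  · exact (hk _ ⟨hMq, hqN⟩).ne' hheight

namespace HeightOffset

lemma matched_splice (H : HeightOffset z z' M N c₁ c₂) (h : Matched z p q) (h' : Matched z p' q')
    (hpM : p < M) (hMq : M ≤ q) (hpN : p' < N) (hNq : N ≤ q')
    (hmid : ∀ j ∈ Set.Icc M N, height z p + c₁ < height z' j)
    (hc : height z p + c₁ = height z p' + c₂) : Matched z' p q' := by
  refine ⟨hpM.trans_le (H.le.trans hNq), ?_, fun j hpj hjq => ?_⟩
  · rw [H.right _ (hNq.trans (Int.le_add_one le_rfl)), h'.height_eq, H.left p hpM.le, hc]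
  rw [H.left p hpM.le]
  rcases le_or_gt j M with hjM | hMj
  · rw [H.left j hjM]
    exact Int.add_lt_add_right (h.lt_height j hpj (hjM.trans hMq)) c₁
  rcases lt_or_ge j N with hjN | hNj
  · exact hmid j ⟨hMj.le, hjN.le⟩
  · rw [H.right j hNj, hc]
    exact Int.add_lt_add_right (h'.lt_height j (hpN.trans_le hNj) hjq) c₂

lemma exists_matched (H : HeightOffset z z' M N c₁ c₂) (hz : z ∈ balancedSet)
    (hk : ∀ j ∈ Set.Icc M N, k < height z j ∧ k + c₁ < height z' j)
    (hk' : ∀ j ∈ Set.Icc M N, k + (c₁ - c₂) < height z j) :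
    ∃ q ≥ N, Matched z (lastBelow z M (k + (c₁ - c₂))) q ∧ Matched z' (lastBelow z M k) q := by
  have hM : M ∈ Set.Icc M N := ⟨le_rfl, H.le⟩
  have hlast (h : ℤ) (hh : h < height z M) :
      lastBelow z M h < M ∧ height z (lastBelow z M h) = h :=
    have hex := exists_lt_height_le hz M h
    ⟨(isGreatest_lastBelow hex).1.1, height_lastBelow hex hh⟩
  obtain ⟨hpM, hp⟩ := hlast _ (hk M hM).1
  obtain ⟨hpM', hp'⟩ := hlast _ (hk' M hM)
  obtain ⟨q, hNq, hq⟩ := exists_matched_lastBelow hz H.le fun j hj => (hk j hj).1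
  obtain ⟨q', hNq', hq'⟩ := exists_matched_lastBelow hz H.le hk'
  refine ⟨q', hNq', hq', H.matched_splice hq hq' hpM (H.le.trans hNq) (hpM'.trans_le H.le) hNq'
    (fun j hj => hp.symm ▸ (hk j hj).2) ?_⟩
  rw [hp, hp']
  ring

end HeightOffset

section DyckShift

variable {m : ℕ} {x y : ℤ → DyckAlphabet m}

lemma stackLabel_eq_of_forall_lt (hM : M ≤ 0) (hN : 0 ≤ N)
    (hk : ∀ j ∈ Set.Icc M N, k < height (bracketType x) j) :
    stackLabel x k = bracketLabel (x (lastBelow (bracketType x) M k)) := by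
  rw [stackLabel, lastBelow_eq_of_forall_lt hM fun l hMl hl => hk l ⟨hMl, hl.le.trans hN⟩]

lemma HeightOffset.bracketLabel_lastBelow_eq
    (H : HeightOffset (bracketType x) (bracketType y) M N c₁ c₂)
    (hz : bracketType x ∈ balancedSet) (hx : x ∈ dyckShift m) (hy : y ∈ dyckShift m)
    (hxy : Set.EqOn x y (Set.Ico M N)ᶜ)
    (hk : ∀ j ∈ Set.Icc M N, k < height (bracketType x) j ∧ k + c₁ < height (bracketType y) j)
    (hk' : ∀ j ∈ Set.Icc M N, k + (c₁ - c₂) < height (bracketType x) j) :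
    bracketLabel (x (lastBelow (bracketType x) M k)) =
      bracketLabel (x (lastBelow (bracketType x) M (k + (c₁ - c₂)))) := by
  obtain ⟨q, hNq, hxq, hyq⟩ := H.exists_matched hz hk hk'
  have hpM := (isGreatest_lastBelow (exists_lt_height_le hz M k)).1.1
  rw [hxy fun hp => hp.1.not_gt hpM, hyq.bracketLabel_eq hy, ← hxy fun hq => hq.2.not_ge hNq,
    hxq.bracketLabel_eq hx]

lemma HeightOffset.exists_exchangeRel
    (H : HeightOffset (bracketType x) (bracketType y) M N c₁ c₁)
    (hz : bracketType x ∈ balancedSet) (hx : x ∈ dyckShift m) (hy : y ∈ dyckShift m)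
    (hxy : Set.EqOn x y (Set.Ico M N)ᶜ) : ∃ r l, ExchangeRel r l x y := by
  obtain ⟨k, hk⟩ :=
    exists_forall_lt_height_and_lt_height (bracketType x) (bracketType y) M N c₁
  have hk₀ (j : ℤ) (hj : j ∈ Set.Icc M N) : k + (c₁ - c₁) < height (bracketType x) j := by
    simpa using (hk j hj).1
  obtain ⟨q, hNq, hxq, hyq⟩ := H.exists_matched hz hk hk₀
  rw [sub_self, add_zero] at hxq
  have hpM := (isGreatest_lastBelow (exists_lt_height_le hz M k)).1.1
  exact ⟨_, _, hxq.excursion.isWellBracketed hx, hyq.excursion.isWellBracketed hy, hxy.mono <|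
    Set.compl_subset_compl.2 (Set.Ico_subset_Ico hpM.le (hNq.trans (Int.le_add_one le_rfl)))⟩

lemma HeightOffset.mem_periodicStackSet
    (H : HeightOffset (bracketType x) (bracketType y) M N c₁ c₂) (hc : c₁ ≠ c₂)
    (hM : M ≤ 0) (hN : 0 ≤ N)
    (hz : bracketType x ∈ balancedSet) (hx : x ∈ dyckShift m) (hy : y ∈ dyckShift m)
    (hxy : Set.EqOn x y (Set.Ico M N)ᶜ) : x ∈ periodicStackSet m := by
  obtain ⟨h₀, hh₀⟩ :=
    exists_forall_lt_height_and_lt_height (bracketType x) (bracketType y) M N c₁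
  refine mem_periodicStackSet_of_shift (h₀ := h₀) (sub_ne_zero.2 hc) fun h hh hd => ?_
  have hk' (j : ℤ) (hj : j ∈ Set.Icc M N) := hd.trans_lt (hh₀ j hj).1
  have hk (j : ℤ) (hj : j ∈ Set.Icc M N) :=
    And.intro (hh.trans_lt (hh₀ j hj).1) ((Int.add_le_add_right hh c₁).trans_lt (hh₀ j hj).2)
  rw [stackLabel_eq_of_forall_lt hM hN fun j hj => (hk j hj).1,
    stackLabel_eq_of_forall_lt hM hN hk', H.bracketLabel_lastBelow_eq hz hx hy hxy hk hk']

lemma DoubleTail.exchangeRel_or_mem_periodicStackSet (h : DoubleTail (dyckShift m) x y)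
    (hz : bracketType x ∈ balancedSet) : (∃ r l, ExchangeRel r l x y) ∨ x ∈ periodicStackSet m := by
  obtain ⟨hx, hy, n, hn⟩ := h
  have hxy : Set.EqOn x y (Set.Ico (-n : ℤ) (n + 1))ᶜ := fun k hk => hn k <| by
    rw [Set.mem_compl_iff, Set.mem_Ico] at hk
    rw [lt_abs]
    omega
  obtain ⟨c₁, c₂, H⟩ := exists_heightOffset (by omega) fun k hk => bracketType_congr (hxy hk)
  by_cases hc : c₁ = c₂
  · subst hc
    exact Or.inl (H.exists_exchangeRel hz hx hy hxy)
  · exact Or.inr (H.mem_periodicStackSet hc (by omega) (by omega) hz hx hy hxy)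

end DyckShift

end DoubleTail

/-! ### Maps that replace finitely many coordinates -/

section PreservesMeasureOn

variable {Ω : Type*} [MeasurableSpace Ω] {μ : Measure Ω} {g g' : Ω → Ω}

namespace PreservesMeasureOn

lemma mono {A B : Set Ω} (h : PreservesMeasureOn μ g A) (hBA : B ⊆ A) :
    PreservesMeasureOn μ g B := fun _ hCB => h (hCB.trans hBA)

lemma congr {A : Set Ω} (h : PreservesMeasureOn μ g A) (hg : Set.EqOn g' g A) :
    PreservesMeasureOn μ g' A := fun B hBA hB => by
  rw [Set.image_congr fun t ht => hg (hBA ht)]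
  exact h hBA hB

lemma measure_image_iUnion {κ : Type*} [Countable κ] {P : κ → Set Ω}
    (h : ∀ i, PreservesMeasureOn μ g (P i)) (hP : ∀ i, MeasurableSet (P i))
    (hg : Set.InjOn g (⋃ i, P i)) : μ (g '' ⋃ i, P i) = μ (⋃ i, P i) := by
  cases isEmpty_or_nonempty κ
  · simp only [Set.iUnion_of_empty, Set.image_empty]
  obtain ⟨f, hf⟩ := exists_surjective_nat κ
  let D : ℕ → Set Ω := disjointed (P ∘ f)
  have hD (n : ℕ) : MeasurableSet (D n) := .disjointed (fun k => hP (f k)) n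
  have hunion : ⋃ i, P i = ⋃ n, D n := (hf.iUnion_comp P).symm.trans iUnion_disjointed.symm
  have hpiece (n : ℕ) := h (f n) (disjointed_subset (P ∘ f) n) (hD n)
  have hdisj : Pairwise (Function.onFun Disjoint D) := disjoint_disjointed _
  rw [hunion] at hg ⊢
  rw [Set.image_iUnion, measure_iUnion (fun i j hij => ?_) fun n => (hpiece n).1,
    measure_iUnion hdisj hD]
  · exact tsum_congr fun n => (hpiece n).2
  · exact (hdisj hij).image hg (Set.subset_iUnion D i) (Set.subset_iUnion D j)

end PreservesMeasureOn

lemma measure_image_eq_of_null_diff {A B : Set Ω} (hBA : B ⊆ A) (hB : μ (g '' B) = μ B)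
    (hdiff : μ (A \ B) = 0) (himage : μ (g '' (A \ B)) = 0) : μ (g '' A) = μ A := by
  rw [← Set.union_sdiff_cancel hBA, Set.image_union,
    measure_congr (union_ae_eq_left_of_ae_eq_empty (ae_eq_empty.2 himage)),
    measure_congr (union_ae_eq_left_of_ae_eq_empty (ae_eq_empty.2 hdiff)), hB]

end PreservesMeasureOn

section ReplacementPiece

variable {ι S : Type*} {A : Set (ι → S)} {g : (ι → S) → ι → S} {K : Finset ι}
  {u v : K → S} {x : ι → S}

/-- The part of `A` where `g` replaces the word `u` at the coordinates in `K` by `v` and fixes all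
other coordinates. -/
def replacementPiece (A : Set (ι → S)) (g : (ι → S) → ι → S) (K : Finset ι) (u v : K → S) :
    Set (ι → S) :=
  {x ∈ A | K.restrict x = u ∧ K.restrict (g x) = v ∧ Set.EqOn x (g x) (K : Set ι)ᶜ}

lemma eqOn_of_mem_replacementPiece {y : ι → S} (hx : x ∈ replacementPiece A g K u v)
    (hy : y ∈ replacementPiece A g K u v) : Set.EqOn y x K := fun n hn =>
  congrFun (hy.2.1.trans hx.2.1.symm) ⟨n, hn⟩

lemma eqOn_piecewise_replacementPiece [DecidableEq ι] (hx : x ∈ replacementPiece A g K u v) :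
    Set.EqOn g (fun t => K.piecewise (g x) t) (replacementPiece A g K u v) := fun t ht => by
  refine funext fun n => ?_
  change g t n = K.piecewise (g x) t n
  by_cases hn : n ∈ K
  · rw [Finset.piecewise_eq_of_mem _ _ _ hn]
    exact congrFun (ht.2.2.1.trans hx.2.2.1.symm) ⟨n, hn⟩
  · rw [Finset.piecewise_eq_of_notMem _ _ _ hn]
    exact (ht.2.2.2 hn).symm

variable [MeasurableSpace S] [MeasurableSingletonClass S] [Countable S]

lemma measurableSet_replacementPiece [Countable ι] (hA : MeasurableSet A)
    (hg : Measurable (A.domRestrict g)) (K : Finset ι) (u v : K → S) :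
    MeasurableSet (replacementPiece A g K u v) := by
  have himage : replacementPiece A g K u v = Subtype.val '' {x : A |
      K.restrict (x : ι → S) = u ∧ K.restrict (A.domRestrict g x) = v ∧
        ∀ n, n ∈ (K : Set ι)ᶜ → (x : ι → S) n = A.domRestrict g x n} := by
    ext x
    exact ⟨fun ⟨hxA, hx⟩ => ⟨⟨x, hxA⟩, hx, rfl⟩, by
      rintro ⟨⟨x, hxA⟩, hx, rfl⟩
      exact ⟨hxA, hx⟩⟩
  have hrestrict := Finset.measurable_restrict (X := fun _ => S) K
  rw [himage]
  refine hA.subtype_image <| MeasurableSet.inter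
    (hrestrict.comp measurable_subtype_coe (measurableSet_singleton u)) <|
    MeasurableSet.inter (hrestrict.comp hg (measurableSet_singleton v)) <|
    measurableSet_setOfPred.2 <| Measurable.forall fun n => measurable_const.imp <|
    measurableSet_setOfPred.1 <| measurableSet_eq_fun ?_ ?_
  · exact (measurable_pi_apply n).comp measurable_subtype_coe
  · exact (measurable_pi_apply n).comp hg

variable [DecidableEq ι] {μ : Measure (ι → S)} [IsFiniteMeasure μ]

lemma IsExchangeableOn.preservesMeasureOn_replacementPiece (h : IsExchangeableOn μ K x (g x))
    (hx : x ∈ replacementPiece A g K u v) :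
    PreservesMeasureOn μ g (replacementPiece A g K u v) :=
  ((preservesMeasureOn_piecewise h).mono fun _ => eqOn_of_mem_replacementPiece hx).congr
    (eqOn_piecewise_replacementPiece hx)

lemma measure_image_eq_of_isExchangeableOn [Countable ι] (hA : MeasurableSet A)
    (hg : Measurable (A.domRestrict g)) (hinj : Set.InjOn g A) {Z : Set (ι → S)} (hZ : μ Z = 0)
    (h : ∀ x ∈ A, (∃ K : Finset ι, Set.EqOn x (g x) (K : Set ι)ᶜ ∧ IsExchangeableOn μ K x (g x)) ∨
      x ∈ Z ∧ g x ∈ Z) : μ (g '' A) = μ A := by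
  let κ := {i : Σ K : Finset ι, (K → S) × (K → S) //
    PreservesMeasureOn μ g (replacementPiece A g i.1 i.2.1 i.2.2)}
  let P : κ → Set (ι → S) := fun i => replacementPiece A g i.1.1 i.1.2.1 i.1.2.2
  have hPA : ⋃ i, P i ⊆ A := Set.iUnion_subset fun i x hx => hx.1
  have hrest (x : ι → S) (hx : x ∈ A \ ⋃ i, P i) : x ∈ Z ∧ g x ∈ Z := by
    refine (h x hx.1).resolve_left fun ⟨K, hfix, hexch⟩ => hx.2 ?_
    have hpiece : x ∈ replacementPiece A g K (K.restrict x) (K.restrict (g x)) :=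
      ⟨hx.1, rfl, rfl, hfix⟩
    exact Set.mem_iUnion.2 ⟨⟨⟨K, _, _⟩, hexch.preservesMeasureOn_replacementPiece hpiece⟩, hpiece⟩
  refine measure_image_eq_of_null_diff hPA ?_
    (measure_mono_null (fun x hx => (hrest x hx).1) hZ)
    (measure_mono_null (Set.image_subset_iff.2 fun x hx => (hrest x hx).2) hZ)
  exact PreservesMeasureOn.measure_image_iUnion (fun i => i.2)
    (fun i => measurableSet_replacementPiece hA hg _ _ _) (hinj.mono hPA)

end ReplacementPiece

/-! ### Invariance of the Dyck measure -/

namespace ExchangeRel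

variable {m : ℕ} {r l : ℤ} {x y : ℤ → DyckAlphabet m}

lemma symm (h : ExchangeRel r l x y) : ExchangeRel r l y x := ⟨h.right, h.left, h.eqOn.symm⟩

lemma piecewise (h : ExchangeRel r l x y) (w : ℤ → DyckAlphabet m) :
    ExchangeRel r l ((Finset.Ico r l).piecewise x w) ((Finset.Ico r l).piecewise y w) := by
  have hin (u : ℤ → DyckAlphabet m) {n : ℤ} (hn : n ∈ Set.Ico r l) :
      (Finset.Ico r l).piecewise u w n = u n :=
    Finset.piecewise_eq_of_mem _ _ _ (Finset.mem_Ico.2 hn)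
  have hwell {u : ℤ → DyckAlphabet m}
      (hu : IsWellBracketed (bracketType u) (bracketLabel ∘ u) r l) :
      IsWellBracketed (bracketType ((Finset.Ico r l).piecewise u w))
        (bracketLabel ∘ (Finset.Ico r l).piecewise u w) r l :=
    hu.congr (fun n hn => bracketType_congr (hin u hn).symm) fun n hn =>
      congrArg bracketLabel (hin u hn).symm
  refine ⟨hwell h.left, hwell h.right, fun n hn => ?_⟩
  have hn' : n ∉ Finset.Ico r l := fun hmem => hn (Finset.mem_Ico.1 hmem)
  rw [Finset.piecewise_eq_of_notMem _ _ _ hn', Finset.piecewise_eq_of_notMem _ _ _ hn']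

lemma isExchangeableOn [NeZero m] (h : ExchangeRel r l x y) :
    IsExchangeableOn (dyckMeasure m) (Finset.Ico r l) x y := fun _ hW w =>
  (h.piecewise w).dyckMeasure_cylinder_eq hW

end ExchangeRel

lemma dyckMeasure_image_eq {m : ℕ} [NeZero m] (hm : 1 < m) {A : Set (ℤ → DyckAlphabet m)}
    {g : (ℤ → DyckAlphabet m) → ℤ → DyckAlphabet m}
    (hg : IsDoubleTailHolonomy (dyckShift m) A g) :
    dyckMeasure m (g '' A) = dyckMeasure m A := by
  have hnull : dyckMeasure m ({x | bracketType x ∉ balancedSet} ∪ periodicStackSet m) = 0 :=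
    measure_union_null ae_bracketType_mem_balancedSet (dyckMeasure_periodicStackSet hm)
  have hmem {x y : ℤ → DyckAlphabet m} (h : DoubleTail (dyckShift m) x y)
      (hxy : ¬∃ r l, ExchangeRel r l x y) :
      x ∈ {x | bracketType x ∉ balancedSet} ∪ periodicStackSet m :=
    or_iff_not_imp_left.2 fun hx =>
      (h.exchangeRel_or_mem_periodicStackSet (not_not.1 hx)).resolve_left hxy
  refine measure_image_eq_of_isExchangeableOn hg.measurableSet hg.measurable hg.injOn hnull
    fun x hx => ?_
  by_cases hxy : ∃ r l, ExchangeRel r l x (g x)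
  · obtain ⟨r, l, hexch⟩ := hxy
    exact Or.inl ⟨Finset.Ico r l, by simpa only [Finset.coe_Ico] using hexch.eqOn,
      hexch.isExchangeableOn⟩
  · exact Or.inr ⟨hmem (hg.rel x hx) hxy,
      hmem (hg.rel x hx).symm fun ⟨r, l, hexch⟩ => hxy ⟨r, l, hexch.symm⟩⟩

theorem mainTheorem1 (m : ℕ) [NeZero m] (hm : 1 < m) :
    IsDoubleTailInvariantProbability (dyckShift m) (dyckMeasure m) where
  isProbabilityMeasure := inferInstance
  measure_eq_one := dyckMeasure_dyckShift
  measure_image _ _ hg := (dyckMeasure_image_eq hm hg).symm
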